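/- Let $n \geq 3$. A tensor Riemannian invariant $T$ of rank $k$ is a formal $\mathbb{R}$-linear combination of partial contractions (with respect to $g^{-1}$, with $k$ free indices) of tensors $\nabla^{N_1}\mathrm{Rm} \otimes \dotsm \otimes \nabla^{N_j}\mathrm{Rm} \otimes g^{\otimes \ell}$. The coefficients are fixed real numbers, so $T$ can be evaluated at pseudo-Riemannian manifolds $(M,g)$ of every dimension; its value is denoted $T^g \in \Gamma(\otimes^k T^\ast M)$. It has weight $w \in \mathbb{R}$ (on $n$-manifolds) if $T^{c^2 g} = c^w T^g$ for every pseudo-Riemannian $n$-manifold $(M^n,g)$ and every constant $c>0$. A tensor Riemannian invariant $T$ of weight $w$ is straightenable if $$ T^{\widetilde g} = \tau^w \pi^\ast T^g , \qquad \tau := t(1+\lambda\rho) , $$ for every $n$-dimensional Einstein manifold $(M^n,g)$, $\mathrm{Ric}_g = 2\lambda(n-1)g$ with $\lambda \in \mathbb{R}$ constant, where $\widetilde g = 2\rho\,dt^2 + 2t\,dt\,d\rho + \tau^2 g$ is the straight and normal ambient metric on $\widetilde{\mathcal G} = (0,\infty)_t \times M \times (-\varepsilon,\varepsilon)_\rho$,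 $\pi \colon \widetilde{\mathcal G} \to M$ is the projection, and $\varepsilon>0$ is such that $\tau>0$ on $\widetilde{\mathcal G}$. Let $w \neq 2$ and let $T_{ab}$ be a straightenable tensor Riemannian invariant of rank $2$ and weight $w$ which is symmetric, i.e. $T^g_{ab} = T^g_{ba}$ on all pseudo-Riemannian $n$-manifolds. Then $$ \nabla^a\nabla^b T_{ab} + \frac{1}{w-2}\,\Delta T_b{}^b , \qquad \Delta := \nabla^a\nabla_a , $$ is a straightenable scalar Riemannian invariant of weight $w-4$. That is, there is a tensor Riemannian invariant $S$ of rank $0$ whose value at every pseudo-Riemannian manifold $(M,g)$ of every dimension is $\nabla^a\nabla^b T^g_{ab} + \frac{1}{w-2}\Delta (T^g)_b{}^b$, and $S$ is straightenable of weight $w-4$. -/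

import Mathlib

open scoped Manifold ContDiff

universe u

namespace RiemInv

/-! ### Tensor calculus in a coordinate system

`E` is the coordinate space with basis `b`; indices run over `ι`.  A metric is given by its component
matrix `G : E → Matrix ι ι ℝ`, and a covariant tensor field of rank `k` by its components
`E → (Fin k → ι) → ℝ`. -/

section Coordinates

variable {E ι : Type*} [NormedAddCommGroup E] [NormedSpace ℝ E] [Fintype ι] [DecidableEq ι]

/-- The partial derivative `∂_i f`. -/
noncomputable def pderiv (b : Module.Basis ι ℝ E) (i : ι) (f : E → ℝ) (x : E) : ℝ :=
  fderiv ℝ f x (b i)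

/-- `Γ_{ij}^l`. -/
noncomputable def christoffel (b : Module.Basis ι ℝ E) (G : E → Matrix ι ι ℝ) (i j l : ι) (x : E) :
    ℝ :=
  (1 / 2) * ∑ m, (G x)⁻¹ l m *
    (pderiv b i (fun y => G y j m) x + pderiv b j (fun y => G y i m) x
      - pderiv b m (fun y => G y i j) x)

/-- The covariant derivative; the first index of the result is the one of the derivative:
`covDeriv b G T x ![i, a₁, …, a_k] = ∇_i T_{a₁ … a_k}`. -/
noncomputable def covDeriv (b : Module.Basis ι ℝ E) (G : E → Matrix ι ι ℝ) {k : ℕ}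
    (T : E → (Fin k → ι) → ℝ) : E → (Fin (k + 1) → ι) → ℝ := fun x a =>
  pderiv b (a 0) (fun y => T y (Fin.tail a)) x
    - ∑ s : Fin k, ∑ l : ι,
        christoffel b G (a 0) (Fin.tail a s) l x * T x (Function.update (Fin.tail a) s l)

/-- `R_{ijm}{}^l`, with the convention
`∇_i ∇_j τ_m - ∇_j ∇_i τ_m = R_{ijm}{}^l τ_l`. -/
noncomputable def riemannUp (b : Module.Basis ι ℝ E) (G : E → Matrix ι ι ℝ) (i j m l : ι) (x : E) :
    ℝ :=
  pderiv b j (christoffel b G i m l) x - pderiv b i (christoffel b G j m l) x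
    + ∑ p, (christoffel b G i m p x * christoffel b G j p l x
        - christoffel b G j m p x * christoffel b G i p l x)

/-- The Riemann curvature tensor `R_{ijml} = R_{ijm}{}^p g_{pl}`. -/
noncomputable def riemann (b : Module.Basis ι ℝ E) (G : E → Matrix ι ι ℝ) :
    E → (Fin 4 → ι) → ℝ := fun x a =>
  ∑ p, riemannUp b G (a 0) (a 1) (a 2) p x * G x p (a 3)

/-- The Ricci tensor `R_{ij} = R_{ipj}{}^p`. -/
noncomputable def ricci (b : Module.Basis ι ℝ E) (G : E → Matrix ι ι ℝ) (i j : ι) (x : E) : ℝ :=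
  ∑ p, riemannUp b G i p j p x

/-- The iterated covariant derivative `∇^N Rm`, a tensor of rank `4 + N`. -/
noncomputable def nablaRiemann (b : Module.Basis ι ℝ E) (G : E → Matrix ι ι ℝ) :
    (N : ℕ) → E → (Fin (4 + N) → ι) → ℝ
  | 0 => riemann b G
  | N + 1 => covDeriv b G (nablaRiemann b G N)

/-- The trace `T_a{}^a` of a tensor of rank `2`, as a tensor of rank `0`. -/
noncomputable def trace₂ (G : E → Matrix ι ι ℝ) (T : E → (Fin 2 → ι) → ℝ) :
    E → (Fin 0 → ι) → ℝ := fun x _ =>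
  ∑ i, ∑ j, (G x)⁻¹ i j * T x ![i, j]

/-- The Laplacian `Δ f = ∇^a ∇_a f` of a scalar. -/
noncomputable def laplacian (b : Module.Basis ι ℝ E) (G : E → Matrix ι ι ℝ)
    (f : E → (Fin 0 → ι) → ℝ) (x : E) : ℝ :=
  ∑ i, ∑ j, (G x)⁻¹ i j * covDeriv b G (covDeriv b G f) x ![i, j]

/-- The double divergence `∇^a ∇^b T_{ab} = g^{ac} g^{bd} ∇_c ∇_d T_{ab}`. -/
noncomputable def doubleDiv (b : Module.Basis ι ℝ E) (G : E → Matrix ι ι ℝ)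
    (T : E → (Fin 2 → ι) → ℝ) (x : E) : ℝ :=
  ∑ i, ∑ j, ∑ p, ∑ q, (G x)⁻¹ i p * (G x)⁻¹ j q *
    covDeriv b G (covDeriv b G T) x ![p, q, i, j]

end Coordinates

/-! ### Formal tensor Riemannian invariants

A tensor Riemannian invariant is given by an expression with fixed real coefficients, so that it can
be evaluated on pseudo-Riemannian manifolds of every dimension. -/

/-- A partial contraction of rank `k` of
`∇^{N₁} Rm ⊗ … ⊗ ∇^{N_j} Rm ⊗ g ⊗ … ⊗ g`.
Every slot of this product is either one of the `k` free slots of the result, or one of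
the two members of exactly one contracted pair. -/
structure Contraction (k : ℕ) where
  /-- number of curvature factors -/
  numCurv : ℕ
  /-- the number of covariant derivatives in each curvature factor -/
  order : Fin numCurv → ℕ
  /-- number of factors `g` -/
  numMetric : ℕ
  /-- number of contracted pairs -/
  numPairs : ℕ
  /-- the positions of the free slots and of the contracted pairs of slots -/
  slots : Fin k ⊕ (Fin numPairs × Fin 2) ≃
    (Σ i : Fin numCurv, Fin (4 + order i)) ⊕ (Fin numMetric × Fin 2)

/-- The components of a partial contraction; contractions are made with `g⁻¹`. -/
noncomputable def Contraction.comp {k : ℕ} (C : Contraction k)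
    {E ι : Type*} [NormedAddCommGroup E] [NormedSpace ℝ E] [Fintype ι] [DecidableEq ι]
    (b : Module.Basis ι ℝ E) (G : E → Matrix ι ι ℝ) : E → (Fin k → ι) → ℝ := fun x a =>
  ∑ p : Fin C.numPairs × Fin 2 → ι,
    (∏ s, (G x)⁻¹ (p (s, 0)) (p (s, 1))) *
    (∏ i, nablaRiemann b G (C.order i) x
      (fun j => Sum.elim a p (C.slots.symm (Sum.inl ⟨i, j⟩)))) *
    ∏ m, G x (Sum.elim a p (C.slots.symm (Sum.inr (m, 0))))
      (Sum.elim a p (C.slots.symm (Sum.inr (m, 1))))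

/-- A tensor Riemannian invariant of rank `k`: a formal `ℝ`-linear combination of partial
contractions. -/
abbrev TensorInvariant (k : ℕ) := Contraction k →₀ ℝ

/-- The components of a tensor Riemannian invariant at a given metric. -/
noncomputable def TensorInvariant.comp {k : ℕ} (T : TensorInvariant k)
    {E ι : Type*} [NormedAddCommGroup E] [NormedSpace ℝ E] [Fintype ι] [DecidableEq ι]
    (b : Module.Basis ι ℝ E) (G : E → Matrix ι ι ℝ) : E → (Fin k → ι) → ℝ := fun x a =>
  T.sum fun C c => c * C.comp b G x a

/-! ### Pseudo-Riemannian manifolds -/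

section Manifolds

variable {E H : Type*} [NormedAddCommGroup E] [NormedSpace ℝ E] [TopologicalSpace H]
  (I : ModelWithCorners ℝ E H) {M : Type*} [TopologicalSpace M] [ChartedSpace H M]

/-- The inverse of the differential of a chart, from the coordinate space to the tangent space at
the point with coordinates `x`.  It maps basis vectors to coordinate vector fields. -/
noncomputable def coordVec (e : OpenPartialHomeomorph M H) (x : E) :
    E →L[ℝ] TangentSpace I ((e.extend I).symm x) :=
  mfderiv 𝓘(ℝ, E) I (e.extend I).symm x

/-- The component matrix of a field of bilinear forms in a chart, as a function of the
coordinates. -/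
noncomputable def metricCoord {ι : Type*} (b : Module.Basis ι ℝ E)
    (g : ∀ p : M, LinearMap.BilinForm ℝ (TangentSpace I p))
    (e : OpenPartialHomeomorph M H) : E → Matrix ι ι ℝ := fun x =>
  Matrix.of fun i j => g ((e.extend I).symm x) (coordVec I e x (b i)) (coordVec I e x (b j))

variable (M) in
/-- A smooth pseudo-Riemannian metric (of arbitrary signature). -/
structure PseudoMetric where
  /-- the bilinear form on each tangent space -/
  form : ∀ p : M, LinearMap.BilinForm ℝ (TangentSpace I p)
  symm : ∀ p v w, form p v w = form p w v
  nondegenerate : ∀ p v, (∀ w, form p v w = 0) → v = 0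
  /-- in every chart of the smooth structure, the components are smooth -/
  smooth : ∀ e ∈ IsManifold.maximalAtlas I ∞ M, ∀ v w : E,
    ContDiffOn ℝ ∞ (fun x => form ((e.extend I).symm x) (coordVec I e x v) (coordVec I e x w))
      (e.extend I).target

/-- The metric `c² g` for a constant `c > 0`. -/
noncomputable def PseudoMetric.rescale {I : ModelWithCorners ℝ E H} (g : PseudoMetric I M) (c : ℝ)
    (hc : 0 < c) : PseudoMetric I M where
  form p := c ^ 2 • g.form p
  symm p v w := by simp [g.symm p v w]
  nondegenerate p v h := g.nondegenerate p v fun w => by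
    have := h w
    simpa [hc.ne'] using this
  smooth e he v w := by
    exact (g.smooth e he v w).const_smul (c ^ 2)

end Manifolds

/-- The standard basis of the coordinate space `ℝⁿ`. -/
noncomputable def stdBasis (n : ℕ) : Module.Basis (Fin n) ℝ (EuclideanSpace ℝ (Fin n)) :=
  (EuclideanSpace.basisFun (Fin n) ℝ).toBasis

section Invariants

variable {n : ℕ} {M : Type u} [TopologicalSpace M] [ChartedSpace (EuclideanSpace ℝ (Fin n)) M]

/-- The components of the metric `g` in the chart `e`. -/
noncomputable def PseudoMetric.coord (g : PseudoMetric (𝓡 n) M)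
    (e : OpenPartialHomeomorph M (EuclideanSpace ℝ (Fin n))) :
    EuclideanSpace ℝ (Fin n) → Matrix (Fin n) (Fin n) ℝ :=
  metricCoord (𝓡 n) (stdBasis n) g.form e

/-- The components of the tensor field `T^g` in the chart `e`. -/
noncomputable def TensorInvariant.eval {k : ℕ} (T : TensorInvariant k) (g : PseudoMetric (𝓡 n) M)
    (e : OpenPartialHomeomorph M (EuclideanSpace ℝ (Fin n))) :
    EuclideanSpace ℝ (Fin n) → (Fin k → Fin n) → ℝ :=
  T.comp (stdBasis n) (g.coord e)

/-- `Ric = 2 λ (n - 1) g`. -/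
def IsEinstein (g : PseudoMetric (𝓡 n) M) (lam : ℝ) : Prop :=
  ∀ e ∈ IsManifold.maximalAtlas (𝓡 n) ∞ M, ∀ x ∈ (e.extend (𝓡 n)).target, ∀ i j,
    ricci (stdBasis n) (g.coord e) i j x = 2 * lam * ((n : ℝ) - 1) * g.coord e x i j

/-! ### The ambient space of an Einstein manifold

The ambient space `(0, ∞)_t × M × (-ε, ε)_ρ` is treated as an open subset of the product manifold
`ℝ × M × ℝ`. -/

/-- The model of the product manifold `ℝ × M × ℝ`. -/
noncomputable abbrev ambModel (n : ℕ) :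
    ModelWithCorners ℝ (ℝ × EuclideanSpace ℝ (Fin n) × ℝ)
      (ModelProd ℝ (ModelProd (EuclideanSpace ℝ (Fin n)) ℝ)) :=
  𝓘(ℝ, ℝ).prod ((𝓡 n).prod 𝓘(ℝ, ℝ))

/-- The indices `0`, `a`, `∞` on the ambient space. -/
abbrev AmbIdx (n : ℕ) := Unit ⊕ (Fin n ⊕ Unit)

/-- The basis of the coordinate space with coordinates `(t, x, ρ)`. -/
noncomputable def ambBasis (n : ℕ) :
    Module.Basis (AmbIdx n) ℝ (ℝ × EuclideanSpace ℝ (Fin n) × ℝ) :=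
  (Module.Basis.singleton Unit ℝ).prod ((stdBasis n).prod (Module.Basis.singleton Unit ℝ))

/-- The chart of `ℝ × M × ℝ` with coordinates `(t, x, ρ)`, where `x` are the coordinates of the
chart `e` of `M`. -/
noncomputable def ambChart (e : OpenPartialHomeomorph M (EuclideanSpace ℝ (Fin n))) :
    OpenPartialHomeomorph (ℝ × M × ℝ) (ModelProd ℝ (ModelProd (EuclideanSpace ℝ (Fin n)) ℝ)) :=
  (OpenPartialHomeomorph.refl ℝ).prod (e.prod (OpenPartialHomeomorph.refl ℝ))

/-- The differential `dt`. -/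
noncomputable def dt (q : ℝ × M × ℝ) : TangentSpace (ambModel n) q →ₗ[ℝ] ℝ :=
  LinearMap.fst ℝ ℝ (EuclideanSpace ℝ (Fin n) × ℝ)

/-- The differential of the projection `(t, p, ρ) ↦ p`. -/
noncomputable def dproj (q : ℝ × M × ℝ) :
    TangentSpace (ambModel n) q →ₗ[ℝ] TangentSpace (𝓡 n) q.2.1 :=
  (LinearMap.fst ℝ (EuclideanSpace ℝ (Fin n)) ℝ).comp
    (LinearMap.snd ℝ ℝ (EuclideanSpace ℝ (Fin n) × ℝ))

/-- The differential `dρ`. -/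
noncomputable def drho (q : ℝ × M × ℝ) : TangentSpace (ambModel n) q →ₗ[ℝ] ℝ :=
  (LinearMap.snd ℝ (EuclideanSpace ℝ (Fin n)) ℝ).comp
    (LinearMap.snd ℝ ℝ (EuclideanSpace ℝ (Fin n) × ℝ))

/-- The bilinear form `2 ρ dt² + 2 t dt dρ + τ² g`, `τ = t (1 + λ ρ)`, at `q = (t, p, ρ)`; here
`2 dt dρ = dt ⊗ dρ + dρ ⊗ dt`. -/
noncomputable def ambForm (g : PseudoMetric (𝓡 n) M) (lam : ℝ) (q : ℝ × M × ℝ) :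
    LinearMap.BilinForm ℝ (TangentSpace (ambModel n) q) :=
  (2 * q.2.2) • LinearMap.BilinForm.linMulLin (dt q) (dt q)
    + q.1 • (LinearMap.BilinForm.linMulLin (dt q) (drho q)
        + LinearMap.BilinForm.linMulLin (drho q) (dt q))
    + (q.1 * (1 + lam * q.2.2)) ^ 2 • (g.form q.2.1).compl₁₂ (dproj q) (dproj q)

/-- The components of the ambient metric in the coordinates `(t, x, ρ)`. -/
noncomputable def ambCoord (g : PseudoMetric (𝓡 n) M) (lam : ℝ)
    (e : OpenPartialHomeomorph M (EuclideanSpace ℝ (Fin n))) :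
    ℝ × EuclideanSpace ℝ (Fin n) × ℝ → Matrix (AmbIdx n) (AmbIdx n) ℝ :=
  metricCoord (ambModel n) (ambBasis n) (ambForm g lam) (ambChart e)

/-- The components of the pullback of a covariant tensor under the projection `(t, x, ρ) ↦ x`. -/
noncomputable def pullbackProj {k : ℕ} (S : (Fin k → Fin n) → ℝ) (A : Fin k → AmbIdx n) : ℝ :=
  ∑ a : Fin k → Fin n, (∏ s, if A s = Sum.inr (Sum.inl (a s)) then (1 : ℝ) else 0) * S a

end Invariants

/-- `T` has weight `w` on `n`-manifolds: `T^{c² g} = c^w T^g`. -/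
def TensorInvariant.HasWeight {k : ℕ} (T : TensorInvariant k) (n : ℕ) (w : ℝ) : Prop :=
  ∀ (M : Type u) [TopologicalSpace M] [T2Space M] [SecondCountableTopology M]
    [ChartedSpace (EuclideanSpace ℝ (Fin n)) M] [IsManifold (𝓡 n) ∞ M]
    (g : PseudoMetric (𝓡 n) M) (c : ℝ) (hc : 0 < c),
    ∀ e ∈ IsManifold.maximalAtlas (𝓡 n) ∞ M, ∀ x ∈ (e.extend (𝓡 n)).target, ∀ a,
      T.eval (g.rescale c hc) e x a = c ^ w * T.eval g e x a

/-- `T_{ab}` is symmetric on `n`-manifolds. -/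
def TensorInvariant.IsSymmetric (T : TensorInvariant 2) (n : ℕ) : Prop :=
  ∀ (M : Type u) [TopologicalSpace M] [T2Space M] [SecondCountableTopology M]
    [ChartedSpace (EuclideanSpace ℝ (Fin n)) M] [IsManifold (𝓡 n) ∞ M]
    (g : PseudoMetric (𝓡 n) M),
    ∀ e ∈ IsManifold.maximalAtlas (𝓡 n) ∞ M, ∀ x ∈ (e.extend (𝓡 n)).target, ∀ i j,
      T.eval g e x ![i, j] = T.eval g e x ![j, i]

/-- `T` is a straightenable tensor Riemannian invariant of weight `w` on `n`-manifolds: it has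
weight `w`, and its evaluation at the straight and normal ambient space
`(0, ∞) × M × (-ε, ε)` of an Einstein manifold `(M, g)` is `τ^w π^* T^g`.  Here `ε` is such that
`τ = t (1 + λ ρ)` is positive on the ambient space. -/
def TensorInvariant.IsStraightenable {k : ℕ} (T : TensorInvariant k) (n : ℕ) (w : ℝ) : Prop :=
  TensorInvariant.HasWeight.{u} T n w ∧
  ∀ (M : Type u) [TopologicalSpace M] [T2Space M] [SecondCountableTopology M]
    [ChartedSpace (EuclideanSpace ℝ (Fin n)) M] [IsManifold (𝓡 n) ∞ M]
    (g : PseudoMetric (𝓡 n) M) (lam : ℝ), IsEinstein g lam →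
    ∀ ε > 0, (∀ ρ ∈ Set.Ioo (-ε) ε, 0 < 1 + lam * ρ) →
    ∀ e ∈ IsManifold.maximalAtlas (𝓡 n) ∞ M,
    ∀ t > 0, ∀ x ∈ (e.extend (𝓡 n)).target, ∀ ρ ∈ Set.Ioo (-ε) ε, ∀ A : Fin k → AmbIdx n,
      T.comp (ambBasis n) (ambCoord g lam e) (t, x, ρ) A
        = (t * (1 + lam * ρ)) ^ w * pullbackProj (T.eval g e x) A

/-- `S` is the scalar invariant `∇^a ∇^b T_{ab} + c Δ T_b{}^b`: the two sides agree on every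
pseudo-Riemannian manifold of every dimension. -/
def IsDoubleDivAddLaplacianTrace (S : TensorInvariant 0) (T : TensorInvariant 2) (c : ℝ) : Prop :=
  ∀ (m : ℕ) (M : Type u) [TopologicalSpace M] [T2Space M] [SecondCountableTopology M]
    [ChartedSpace (EuclideanSpace ℝ (Fin m)) M] [IsManifold (𝓡 m) ∞ M]
    (g : PseudoMetric (𝓡 m) M),
    ∀ e ∈ IsManifold.maximalAtlas (𝓡 m) ∞ M, ∀ x ∈ (e.extend (𝓡 m)).target, ∀ a,
      S.eval g e x a
        = doubleDiv (stdBasis m) (g.coord e) (T.eval g e) x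
          + c * laplacian (stdBasis m) (g.coord e) (trace₂ (g.coord e) (T.eval g e)) x

end RiemInv

/-! # Straightenability of `∇^a ∇^b T_{ab} + (w - 2)⁻¹ Δ T_b{}^b` -/

namespace RiemInv

/-! ### Partial derivatives -/

section PartialDerivatives

variable {E ι : Type*} [NormedAddCommGroup E] [NormedSpace ℝ E] {b : Module.Basis ι ℝ E} {i : ι}
  {f g : E → ℝ} {x : E}

/-! The invariant exists because the Levi-Civita derivative is a derivation that kills `g` and `g⁻¹`
and commutes with contractions. The derivative of a partial contraction is therefore the sum, over
its curvature factors, of the contraction in which that factor carries one more derivative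
(`Contraction.covDeriv_comp`); contracting free slots is formal as well
(`Contraction.comp_contract`). One formal combination thus computes the double divergence plus `c`
times the Laplacian of the trace for every metric on an open set of any coordinate space, the
ambient metric included (`TensorInvariant.comp_doubleDivAddLaplacianTrace`). Its weight is `w - 4`:
a constant factor does not change the connection, and each term contracts twice with `g⁻¹`.

Straightness rests on two facts about `τ = t (1 + λρ)` in the ambient metric: `|dτ|² = 2λ`, and the
Hessian of `τ` is `2λτ π^*g`. They give `div (τ^r π^*α + c τ^(r-1) f dτ) = τ^(r-2) (div α + 2λc (r -
1 + n) f)` for a 1-form `α` and a function `f` on the base (`IsAmbientOn.divergence_eq`). Write `tr`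
for the trace of `T`. If the ambient value of `T` is `τ^w π^*T`, then its divergence is `τ^(w-2)
π^*(div T) - τ^(w-3) tr dτ`, while the differential of its trace is `τ^(w-2) π^*(d tr) + (w-2)
τ^(w-3) tr dτ`. Both have the form above with `r = w - 2`, and with `c = -1` and `c = w - 2`
respectively. Besides the straight part, the second divergences leave multiples of `2λ (w - 3 + n)
tr` in the ratio `-1 : w - 2`, which the coefficient `1/(w-2)` cancels.

The Einstein condition enters only through the hypothesis on `T`; the divergence formulas hold over
any base metric. -/

theorem pderiv_congr (h : f =ᶠ[nhds x] g) : pderiv b i f x = pderiv b i g x := by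
  rw [pderiv, pderiv, h.fderiv_eq]

theorem pderiv_const (c : ℝ) : pderiv b i (fun _ => c) x = 0 := by
  simp [pderiv]

theorem pderiv_mul (hf : DifferentiableAt ℝ f x) (hg : DifferentiableAt ℝ g x) :
    pderiv b i (fun y => f y * g y) x = pderiv b i f x * g x + f x * pderiv b i g x := by
  simp only [pderiv, fderiv_fun_mul hf hg, add_apply, FunLike.coe_smul, Pi.smul_apply, smul_eq_mul]
  ring

theorem pderiv_const_mul (c : ℝ) (hf : DifferentiableAt ℝ f x) :
    pderiv b i (fun y => c * f y) x = c * pderiv b i f x := by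
  rw [pderiv_mul (differentiableAt_const c) hf, pderiv_const, zero_mul, zero_add]

theorem pderiv_sum {α : Type*} (s : Finset α) {f : α → E → ℝ}
    (hf : ∀ j ∈ s, DifferentiableAt ℝ (f j) x) :
    pderiv b i (fun y => ∑ j ∈ s, f j y) x = ∑ j ∈ s, pderiv b i (f j) x := by
  simp [pderiv, fderiv_fun_sum hf]

theorem pderiv_prod {α : Type*} [DecidableEq α] (s : Finset α) {f : α → E → ℝ}
    (hf : ∀ j ∈ s, DifferentiableAt ℝ (f j) x) :
    pderiv b i (fun y => ∏ j ∈ s, f j y) x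
      = ∑ j ∈ s, pderiv b i (f j) x * ∏ l ∈ s.erase j, f l x := by
  have h := HasFDerivAt.finsetProd (u := s) (g := f) (x := x) (g' := fun j => fderiv ℝ (f j) x)
    (fun j hj => (hf j hj).hasFDerivAt)
  have h' : fderiv ℝ (fun y => ∏ j ∈ s, f j y) x = _ := (by
    convert h using 1 : HasFDerivAt (fun y => ∏ j ∈ s, f j y) _ x).fderiv
  rw [pderiv, h']
  simp [pderiv, mul_comm]

theorem ContDiffAt.pderiv (b : Module.Basis ι ℝ E) (i : ι) (hf : ContDiffAt ℝ ∞ f x) :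
    ContDiffAt ℝ ∞ (pderiv b i f) x :=
  (hf.fderiv_right (m := ∞) (by simp)).clm_apply contDiffAt_const

theorem differentiableAt_of_contDiffAt (hf : ContDiffAt ℝ ∞ f x) : DifferentiableAt ℝ f x :=
  hf.differentiableAt (by simp)

end PartialDerivatives

/-! ### The action of a matrix on covariant tensors by derivations -/

section MatrixAction

variable {ι K : Type*} [Fintype ι] [Fintype K] [DecidableEq K]

/-- The action of the matrix `A` by a derivation on tensors with slots `K`. -/
def slotAction (A : ι → ι → ℝ) (w : (K → ι) → ℝ) (q : K → ι) : ℝ :=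
  ∑ s, ∑ l, A (q s) l * w (Function.update q s l)

theorem slotAction_sum_mul {α : Type*} (A : ι → ι → ℝ) (s : Finset α)
    (c : α → ℝ) (w : α → (K → ι) → ℝ) (q : K → ι) :
    slotAction A (fun r => ∑ C ∈ s, c C * w C r) q = ∑ C ∈ s, c C * slotAction A (w C) q := by
  simp only [slotAction, Finset.mul_sum]
  rw [Finset.sum_comm (s := s)]
  refine Finset.sum_congr rfl fun j _ => ?_
  rw [Finset.sum_comm (s := s)]
  exact Finset.sum_congr rfl fun l _ => Finset.sum_congr rfl fun C _ => by ring

theorem slotAction_reindex {K' : Type*} [Fintype K'] [DecidableEq K'] (e : K ≃ K')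
    (A : ι → ι → ℝ) (w : (K → ι) → ℝ) (q : K' → ι) :
    slotAction A (fun r : K' → ι => w (r ∘ e)) q = slotAction A w (q ∘ e) := by
  unfold slotAction
  rw [← e.sum_comp]
  refine Finset.sum_congr rfl fun s _ => Finset.sum_congr rfl fun l _ => ?_
  have h : Function.update q (e s) l ∘ e = Function.update (q ∘ e) s l :=
    Function.update_comp_eq_of_injective q e.injective s l
  simp only [h, Function.comp_apply]

theorem slotAction_mul_sum {K' : Type*} [Fintype K'] [DecidableEq K'] (A : ι → ι → ℝ)
    (u : (K → ι) → ℝ) (v : (K' → ι) → ℝ) (q : K ⊕ K' → ι) :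
    slotAction A (fun r : K ⊕ K' → ι => u (r ∘ Sum.inl) * v (r ∘ Sum.inr)) q
      = slotAction A u (q ∘ Sum.inl) * v (q ∘ Sum.inr)
        + u (q ∘ Sum.inl) * slotAction A v (q ∘ Sum.inr) := by
  simp only [slotAction, Fintype.sum_sum_type, Finset.sum_mul, Finset.mul_sum]
  congr 1 <;> refine Finset.sum_congr rfl fun s _ => Finset.sum_congr rfl fun l _ => ?_
  · have h1 : Function.update q (Sum.inl s) l ∘ Sum.inl = Function.update (q ∘ Sum.inl) s l :=
      Function.update_comp_eq_of_injective q Sum.inl_injective s l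
    have h2 : Function.update q (Sum.inl s) l ∘ Sum.inr = q ∘ Sum.inr := by
      ext j; simp
    rw [h1, h2, Function.comp_apply]; ring
  · have h1 : Function.update q (Sum.inr s) l ∘ Sum.inr = Function.update (q ∘ Sum.inr) s l :=
      Function.update_comp_eq_of_injective q Sum.inr_injective s l
    have h2 : Function.update q (Sum.inr s) l ∘ Sum.inl = q ∘ Sum.inl := by
      ext j; simp
    rw [h1, h2, Function.comp_apply]; ring

/-- Changing an index in one factor leaves all other factors alone, so the action satisfies the
Leibniz rule over a product indexed by `F`. -/
theorem slotAction_prod_sigma {F : Type*} [Fintype F] [DecidableEq F] {κ : F → Type*}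
    [∀ f, Fintype (κ f)] [∀ f, DecidableEq (κ f)] (A : ι → ι → ℝ)
    (u : ∀ f, (κ f → ι) → ℝ) (q : (Σ f, κ f) → ι) :
    slotAction A (fun r : (Σ f, κ f) → ι => ∏ f, u f fun j => r ⟨f, j⟩) q
      = ∑ f, slotAction A (u f) (fun j => q ⟨f, j⟩)
          * ∏ f' ∈ Finset.univ.erase f, u f' fun j => q ⟨f', j⟩ := by
  simp only [slotAction, Fintype.sum_sigma, Finset.sum_mul]
  refine Finset.sum_congr rfl fun f _ => Finset.sum_congr rfl fun s _ =>
    Finset.sum_congr rfl fun l _ => ?_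
  rw [mul_assoc, ← Finset.mul_prod_erase Finset.univ _ (Finset.mem_univ f)]
  congr 2
  · congr 1
    exact Function.update_comp_eq_of_injective q (sigma_mk_injective (i := f)) s l
  · refine Finset.prod_congr rfl fun f' hf' => ?_
    congr 1
    ext j
    rw [Function.update_of_ne]
    rintro h
    exact Finset.ne_of_mem_erase hf' (congrArg Sigma.fst h)

theorem slotAction_pair (A : ι → ι → ℝ) (B : ι → ι → ℝ) (q : Fin 2 → ι) :
    slotAction A (fun r => B (r 0) (r 1)) q
      = ∑ l, A (q 0) l * B l (q 1) + ∑ l, A (q 1) l * B (q 0) l := by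
  simp [slotAction, Fin.sum_univ_two]

theorem slotAction_prod_pairs {F : Type*} [Fintype F] [DecidableEq F] (A : ι → ι → ℝ)
    (B : ι → ι → ℝ) (q : F × Fin 2 → ι) :
    slotAction A (fun r : F × Fin 2 → ι => ∏ f, B (r (f, 0)) (r (f, 1))) q
      = ∑ f, (∑ l, A (q (f, 0)) l * B l (q (f, 1)) + ∑ l, A (q (f, 1)) l * B (q (f, 0)) l)
          * ∏ f' ∈ Finset.univ.erase f, B (q (f', 0)) (q (f', 1)) := by
  have h := slotAction_reindex (Equiv.sigmaEquivProd F (Fin 2)) A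
    (fun r : (Σ _ : F, Fin 2) → ι => ∏ f, B (r ⟨f, 0⟩) (r ⟨f, 1⟩)) q
  have h' := slotAction_prod_sigma (F := F) (κ := fun _ => Fin 2) A
    (fun _ r => B (r 0) (r 1)) (q ∘ Equiv.sigmaEquivProd F (Fin 2))
  simp only [slotAction_pair] at h'
  exact h.trans h'

/-- Summation by parts in one slot: exchanging the old value of the slot with the new one is an
involution on pairs (index function, new value), and it moves the matrix, transposed, to the other
tensor. -/
theorem sum_slotAction_transpose [DecidableEq ι] (A : ι → ι → ℝ) (u v : (K → ι) → ℝ) :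
    ∑ q, u q * slotAction A v q = ∑ q, slotAction (fun i j => A j i) u q * v q := by
  simp only [slotAction, Finset.mul_sum, Finset.sum_mul]
  rw [Finset.sum_comm, Finset.sum_comm (s := Finset.univ (α := K → ι))]
  refine Finset.sum_congr rfl fun s _ => ?_
  simp only [← Fintype.sum_prod_type']
  let e : (K → ι) × ι ≃ (K → ι) × ι :=
    Function.Involutive.toPerm (fun z => (Function.update z.1 s z.2, z.1 s)) (fun z => by simp)
  rw [← e.sum_comp]
  refine Finset.sum_congr rfl fun z _ => ?_
  have h : e z = (Function.update z.1 s z.2, z.1 s) := rfl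
  simp only [h, Function.update_self, Function.update_idem, Function.update_eq_self]
  ring

/-- The action on the free slots is the action on all slots minus that on the contracted ones, and
the latter passes transposed to the weight `Q`. With `Q` a product of inverse metrics, this last
term is what the derivative of `Q` will cancel. -/
theorem slotAction_sum_elim_sum {P : Type*} [Fintype P] [DecidableEq P] [DecidableEq ι]
    (A : ι → ι → ℝ) (Q : (P → ι) → ℝ) (w : (K ⊕ P → ι) → ℝ) (a : K → ι) :
    slotAction A (fun r => ∑ p, Q p * w (Sum.elim r p)) a
      = ∑ p, Q p * slotAction A w (Sum.elim a p)
        - ∑ p, slotAction (fun i j => A j i) Q p * w (Sum.elim a p) := by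
  have h : ∀ p, Q p * slotAction A w (Sum.elim a p)
      - Q p * slotAction A (fun p => w (Sum.elim a p)) p
      = ∑ s, ∑ l, A (a s) l * (Q p * w (Sum.elim (Function.update a s l) p)) := by
    intro p
    simp only [slotAction, Fintype.sum_sum_type, Sum.elim_inl, Sum.elim_inr,
      Sum.update_elim_inl, Sum.update_elim_inr, mul_add, add_sub_cancel_right]
    simp only [Finset.mul_sum]
    refine Finset.sum_congr rfl fun s _ => Finset.sum_congr rfl fun l _ => ?_
    ring
  have h' := sum_slotAction_transpose A Q
  simp only [← h', ← Finset.sum_sub_distrib, h]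
  simp only [slotAction, Finset.mul_sum]
  rw [Finset.sum_comm (s := Finset.univ (α := P → ι))]
  refine Finset.sum_congr rfl fun s _ => ?_
  rw [Finset.sum_comm (s := Finset.univ (α := P → ι))]

end MatrixAction

/-! ### Metrics on open subsets of the coordinate space -/

section Metrics

variable {E ι : Type*} [NormedAddCommGroup E] [NormedSpace ℝ E] [Fintype ι] [DecidableEq ι]

/-- `G` is a smooth pseudo-Riemannian metric on the open set `U`. -/
structure IsMetricOn (G : E → Matrix ι ι ℝ) (U : Set E) : Prop where
  isOpen : IsOpen U
  smooth : ∀ i j, ∀ x ∈ U, ContDiffAt ℝ ∞ (fun y => G y i j) x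
  symm : ∀ x ∈ U, ∀ i j, G x i j = G x j i
  det_ne_zero : ∀ x ∈ U, (G x).det ≠ 0

/-- The components of `T` are smooth on `U`. -/
def IsSmoothTensorOn {K : Type*} (T : E → (K → ι) → ℝ) (U : Set E) : Prop :=
  ∀ a, ∀ x ∈ U, ContDiffAt ℝ ∞ (fun y => T y a) x

theorem contDiffAt_det {α : Type*} [Fintype α] [DecidableEq α] {A : E → Matrix α α ℝ} {x : E}
    (h : ∀ i j, ContDiffAt ℝ ∞ (fun y => A y i j) x) :
    ContDiffAt ℝ ∞ (fun y => (A y).det) x := by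
  simp only [Matrix.det_apply]
  exact ContDiffAt.sum fun σ _ => (contDiffAt_prod fun i _ => h _ _).const_smul _

namespace IsMetricOn

variable {G : E → Matrix ι ι ℝ} {U : Set E} (hG : IsMetricOn G U)
include hG

theorem eventually_mem {x : E} (hx : x ∈ U) : ∀ᶠ y in nhds x, y ∈ U :=
  hG.isOpen.mem_nhds hx

theorem mul_inv {x : E} (hx : x ∈ U) : G x * (G x)⁻¹ = 1 :=
  Matrix.mul_nonsing_inv _ (isUnit_iff_ne_zero.mpr (hG.det_ne_zero x hx))

theorem inv_mul {x : E} (hx : x ∈ U) : (G x)⁻¹ * G x = 1 :=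
  Matrix.nonsing_inv_mul _ (isUnit_iff_ne_zero.mpr (hG.det_ne_zero x hx))

theorem transpose_eq {x : E} (hx : x ∈ U) : (G x).transpose = G x := by
  ext i j
  exact hG.symm x hx j i

theorem inv_transpose_eq {x : E} (hx : x ∈ U) : ((G x)⁻¹).transpose = (G x)⁻¹ := by
  rw [Matrix.transpose_nonsing_inv, hG.transpose_eq hx]

theorem inv_symm {x : E} (hx : x ∈ U) (i j : ι) : (G x)⁻¹ i j = (G x)⁻¹ j i :=
  congrFun (congrFun (hG.inv_transpose_eq hx) j) i

theorem contDiffAt_inv {x : E} (hx : x ∈ U) (i j : ι) :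
    ContDiffAt ℝ ∞ (fun y => (G y)⁻¹ i j) x := by
  -- Cramer's rule reduces smoothness of the inverse to smoothness of determinants and of one
  -- reciprocal.
  have h : ∀ y, (G y)⁻¹ i j = ((G y).det)⁻¹ * ((G y).updateRow j (Pi.single i 1)).det := by
    intro y
    rw [Matrix.inv_def, Matrix.smul_apply, Matrix.adjugate_apply, Ring.inverse_eq_inv', smul_eq_mul]
  simp only [h]
  refine ((contDiffAt_det fun i j => hG.smooth i j x hx).inv (hG.det_ne_zero x hx)).mul
    (contDiffAt_det fun k l => ?_)
  by_cases hk : k = j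
  · subst hk
    simp only [Matrix.updateRow_self]
    exact contDiffAt_const
  · simp only [Matrix.updateRow_ne hk]
    exact hG.smooth _ _ x hx

variable (b : Module.Basis ι ℝ E)

theorem contDiffAt_christoffel {x : E} (hx : x ∈ U) (i j l : ι) :
    ContDiffAt ℝ ∞ (christoffel b G i j l) x := by
  unfold christoffel
  refine contDiffAt_const.mul (ContDiffAt.sum fun m _ => (hG.contDiffAt_inv hx l m).mul ?_)
  exact ((ContDiffAt.pderiv b i (hG.smooth j m x hx)).add
    (ContDiffAt.pderiv b j (hG.smooth i m x hx))).sub (ContDiffAt.pderiv b m (hG.smooth i j x hx))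

theorem contDiffAt_riemannUp {x : E} (hx : x ∈ U) (i j m l : ι) :
    ContDiffAt ℝ ∞ (riemannUp b G i j m l) x := by
  unfold riemannUp
  have h := fun i j l => hG.contDiffAt_christoffel b hx i j l
  exact ((ContDiffAt.pderiv b j (h i m l)).sub (ContDiffAt.pderiv b i (h j m l))).add
    (ContDiffAt.sum fun p _ => ((h i m p).mul (h j p l)).sub ((h j m p).mul (h i p l)))

theorem isSmooth_covDeriv {k : ℕ} {T : E → (Fin k → ι) → ℝ} (hT : IsSmoothTensorOn T U) :
    IsSmoothTensorOn (covDeriv b G T) U := by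
  intro a x hx
  unfold covDeriv
  exact (ContDiffAt.pderiv b _ (hT _ x hx)).sub (ContDiffAt.sum fun s _ => ContDiffAt.sum fun l _ =>
    (hG.contDiffAt_christoffel b hx _ _ _).mul (hT _ x hx))

theorem isSmooth_nablaRiemann : ∀ N, IsSmoothTensorOn (nablaRiemann b G N) U
  | 0 => fun _ _ hx => ContDiffAt.sum fun _ _ =>
      (hG.contDiffAt_riemannUp b hx _ _ _ _).mul (hG.smooth _ _ _ hx)
  | N + 1 => hG.isSmooth_covDeriv b (isSmooth_nablaRiemann N)

theorem pderiv_symm {x : E} (hx : x ∈ U) (i j k : ι) :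
    pderiv b i (fun y => G y j k) x = pderiv b i (fun y => G y k j) x :=
  pderiv_congr ((hG.eventually_mem hx).mono fun y hy => hG.symm y hy j k)

theorem christoffel_lower {x : E} (hx : x ∈ U) (i j k : ι) :
    ∑ l, christoffel b G i j l x * G x l k
      = (1 / 2) * (pderiv b i (fun y => G y j k) x + pderiv b j (fun y => G y i k) x
        - pderiv b k (fun y => G y i j) x) := by
  simp only [christoffel, mul_assoc, ← Finset.mul_sum, Finset.sum_mul]
  rw [Finset.sum_comm]
  have h : ∀ m, ∑ l, (G x)⁻¹ l m * G x l k = if m = k then 1 else 0 := by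
    intro m
    have := congrFun (congrFun (hG.inv_mul hx) m) k
    rw [Matrix.mul_apply, Matrix.one_apply] at this
    rw [← this]
    exact Finset.sum_congr rfl fun l _ => by rw [hG.inv_symm hx]
  congr 1
  calc _ = ∑ m, (∑ l, (G x)⁻¹ l m * G x l k) * (pderiv b i (fun y => G y j m) x
        + pderiv b j (fun y => G y i m) x - pderiv b m (fun y => G y i j) x) := by
        refine Finset.sum_congr rfl fun m _ => ?_
        rw [Finset.sum_mul]
        exact Finset.sum_congr rfl fun l _ => by ring
    _ = _ := by simp [h]

/-- The Levi-Civita connection is metric. -/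
theorem pderiv_metric {x : E} (hx : x ∈ U) (i j k : ι) :
    pderiv b i (fun y => G y j k) x
      = ∑ l, christoffel b G i j l x * G x l k + ∑ l, christoffel b G i k l x * G x j l := by
  simp only [hG.symm x hx j, hG.christoffel_lower b hx]
  rw [hG.pderiv_symm b hx i k j, hG.pderiv_symm b hx j i k]
  ring

/-- Differentiate `G⁻¹ G = 1`, insert the metric property of the connection for the derivative of
`G`, and solve for the derivative of `G⁻¹`. -/
theorem pderiv_inv {x : E} (hx : x ∈ U) (i j k : ι) :
    pderiv b i (fun y => (G y)⁻¹ j k) x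
      = - (∑ l, christoffel b G i l j x * (G x)⁻¹ l k
        + ∑ l, christoffel b G i l k x * (G x)⁻¹ j l) := by
  let A : Matrix ι ι ℝ := Matrix.of fun m l => christoffel b G i m l x
  let D : Matrix ι ι ℝ := Matrix.of fun j k => pderiv b i (fun y => (G y)⁻¹ j k) x
  let DG : Matrix ι ι ℝ := Matrix.of fun j k => pderiv b i (fun y => G y j k) x
  have h1 : DG = A * G x + G x * A.transpose := by
    ext j k
    simp only [DG, A, Matrix.add_apply, Matrix.mul_apply, Matrix.transpose_apply, Matrix.of_apply]
    rw [hG.pderiv_metric b hx]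
    congr 1
    exact Finset.sum_congr rfl fun l _ => mul_comm _ _
  have h2 : D * G x + (G x)⁻¹ * DG = 0 := by
    ext j k
    simp only [D, DG, Matrix.add_apply, Matrix.mul_apply, Matrix.of_apply, Matrix.zero_apply]
    rw [← Finset.sum_add_distrib]
    have hd : ∀ m, pderiv b i (fun y => (G y)⁻¹ j m * G y m k) x = _ := fun m =>
      pderiv_mul (differentiableAt_of_contDiffAt (hG.contDiffAt_inv hx j m))
        (differentiableAt_of_contDiffAt (hG.smooth m k x hx))
    simp only [← hd]
    rw [← pderiv_sum Finset.univ fun m _ => differentiableAt_of_contDiffAt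
      ((hG.contDiffAt_inv hx j m).mul (hG.smooth m k x hx))]
    rw [← pderiv_const (E := E) (b := b) (i := i) (x := x) ((1 : Matrix ι ι ℝ) j k)]
    refine pderiv_congr ((hG.eventually_mem hx).mono fun y hy => ?_)
    simp only [← Matrix.mul_apply, hG.inv_mul hy]
  have h3 : D = -(A.transpose * (G x)⁻¹ + (G x)⁻¹ * A) := by
    calc D = D * (G x * (G x)⁻¹) := by rw [hG.mul_inv hx, mul_one]
      _ = (D * G x + (G x)⁻¹ * DG) * (G x)⁻¹ - (G x)⁻¹ * DG * (G x)⁻¹ := by noncomm_ring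
      _ = - ((G x)⁻¹ * A * (G x * (G x)⁻¹) + ((G x)⁻¹ * G x) * A.transpose * (G x)⁻¹) := by
        rw [h2, h1]; noncomm_ring
      _ = _ := by rw [hG.mul_inv hx, hG.inv_mul hx, mul_one, one_mul, add_comm]
  have h4 := congrFun (congrFun h3 j) k
  simp only [D, A, Matrix.neg_apply, Matrix.add_apply, Matrix.mul_apply, Matrix.transpose_apply,
    Matrix.of_apply] at h4
  rw [h4]
  congr 2
  exact Finset.sum_congr rfl fun l _ => mul_comm _ _

end IsMetricOn

/-! ### Covariant derivatives of tensors with arbitrary slots -/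

/-- The covariant derivative `∇_i W` of a tensor with slots `K`. -/
noncomputable def covAlong {K : Type*} [Fintype K] [DecidableEq K] (b : Module.Basis ι ℝ E)
    (G : E → Matrix ι ι ℝ) (i : ι) (W : E → (K → ι) → ℝ) (x : E) (q : K → ι) : ℝ :=
  pderiv b i (fun y => W y q) x - slotAction (fun j l => christoffel b G i j l x) (W x) q

/-- Splitting off the index of the derivative frees the other slots to form an arbitrary finite
type, so that products and contractions can use sum types instead of arithmetic in `Fin`. -/
theorem covDeriv_eq_covAlong (b : Module.Basis ι ℝ E) (G : E → Matrix ι ι ℝ) {k : ℕ}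
    (T : E → (Fin k → ι) → ℝ) (x : E) (a : Fin (k + 1) → ι) :
    covDeriv b G T x a = covAlong b G (a 0) T x (Fin.tail a) := rfl

theorem covAlong_reindex {K K' : Type*} [Fintype K] [DecidableEq K] [Fintype K'] [DecidableEq K']
    (e : K ≃ K') (b : Module.Basis ι ℝ E) (G : E → Matrix ι ι ℝ) (i : ι) (W : E → (K → ι) → ℝ)
    (x : E) (q : K' → ι) :
    covAlong b G i (fun y r => W y (r ∘ e)) x q = covAlong b G i W x (q ∘ e) := by
  rw [covAlong, slotAction_reindex, covAlong]

theorem covAlong_mul {K K' : Type*} [Fintype K] [DecidableEq K] [Fintype K'] [DecidableEq K']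
    (b : Module.Basis ι ℝ E) (G : E → Matrix ι ι ℝ) (i : ι) {V : E → (K → ι) → ℝ}
    {W : E → (K' → ι) → ℝ} {x : E} (hV : ∀ a, DifferentiableAt ℝ (fun y => V y a) x)
    (hW : ∀ a, DifferentiableAt ℝ (fun y => W y a) x) (q : K ⊕ K' → ι) :
    covAlong b G i (fun y r => V y (r ∘ Sum.inl) * W y (r ∘ Sum.inr)) x q
      = covAlong b G i V x (q ∘ Sum.inl) * W x (q ∘ Sum.inr)
        + V x (q ∘ Sum.inl) * covAlong b G i W x (q ∘ Sum.inr) := by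
  rw [covAlong, slotAction_mul_sum, pderiv_mul (hV _) (hW _), covAlong, covAlong]
  ring

theorem covAlong_prod {F : Type*} [Fintype F] [DecidableEq F] {κ : F → Type*}
    [∀ f, Fintype (κ f)] [∀ f, DecidableEq (κ f)] (b : Module.Basis ι ℝ E) (G : E → Matrix ι ι ℝ)
    (i : ι) {W : ∀ f, E → (κ f → ι) → ℝ} {x : E}
    (hW : ∀ f a, DifferentiableAt ℝ (fun y => W f y a) x) (q : (Σ f, κ f) → ι) :
    covAlong b G i (fun y r => ∏ f, W f y fun j => r ⟨f, j⟩) x q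
      = ∑ f, covAlong b G i (W f) x (fun j => q ⟨f, j⟩)
          * ∏ f' ∈ Finset.univ.erase f, W f' x fun j => q ⟨f', j⟩ := by
  simp only [covAlong]
  rw [slotAction_prod_sigma, pderiv_prod _ fun f _ => hW f _, ← Finset.sum_sub_distrib]
  simp only [sub_mul]

namespace IsMetricOn

variable {G : E → Matrix ι ι ℝ} {U : Set E} (hG : IsMetricOn G U) (b : Module.Basis ι ℝ E)
include hG

/-- By the Leibniz rule this is `∇g = 0` applied to each factor. -/
theorem covAlong_prod_metric {F : Type*} [Fintype F] [DecidableEq F] {x : E} (hx : x ∈ U) (i : ι)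
    (q : F × Fin 2 → ι) :
    covAlong b G i (fun y (r : F × Fin 2 → ι) => ∏ f, G y (r (f, 0)) (r (f, 1))) x q = 0 := by
  rw [covAlong, slotAction_prod_pairs _ (G x), pderiv_prod _ fun f _ =>
    differentiableAt_of_contDiffAt (hG.smooth _ _ x hx)]
  simp only [hG.pderiv_metric b hx, sub_self]

/-- This is `∇g⁻¹ = 0`. The indices of `g⁻¹` are upper ones, hence the sign and the transposed
Christoffel matrix. -/
theorem pderiv_prod_inv {F : Type*} [Fintype F] [DecidableEq F] {x : E} (hx : x ∈ U) (i : ι)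
    (q : F × Fin 2 → ι) :
    pderiv b i (fun y => ∏ f, (G y)⁻¹ (q (f, 0)) (q (f, 1))) x
      = - slotAction (fun j l => christoffel b G i l j x)
        (fun r : F × Fin 2 → ι => ∏ f, (G x)⁻¹ (r (f, 0)) (r (f, 1))) q := by
  refine (pderiv_prod _ fun f _ =>
    differentiableAt_of_contDiffAt (hG.contDiffAt_inv hx _ _)).trans (Eq.trans ?_
      (congrArg Neg.neg (slotAction_prod_pairs (fun j l => christoffel b G i l j x)
        ((G x)⁻¹ : Matrix ι ι ℝ) q).symm))
  simp only [hG.pderiv_inv b hx, neg_mul, Finset.sum_neg_distrib]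

/-- Covariant derivatives commute with contractions. -/
theorem covAlong_contract {K F : Type*} [Fintype K] [DecidableEq K] [Fintype F] [DecidableEq F]
    {x : E} (hx : x ∈ U) (i : ι) {W : E → (K ⊕ F × Fin 2 → ι) → ℝ}
    (hW : ∀ a, DifferentiableAt ℝ (fun y => W y a) x) (a : K → ι) :
    covAlong b G i (fun y r => ∑ p : F × Fin 2 → ι,
        (∏ f, (G y)⁻¹ (p (f, 0)) (p (f, 1))) * W y (Sum.elim r p)) x a
      = ∑ p : F × Fin 2 → ι, (∏ f, (G x)⁻¹ (p (f, 0)) (p (f, 1)))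
          * covAlong b G i W x (Sum.elim a p) := by
  have hQ : ∀ p : F × Fin 2 → ι, DifferentiableAt ℝ
      (fun y => ∏ f, (G y)⁻¹ (p (f, 0)) (p (f, 1))) x := fun p =>
    differentiableAt_of_contDiffAt (contDiffAt_prod fun f _ => hG.contDiffAt_inv hx _ _)
  rw [covAlong, slotAction_sum_elim_sum, pderiv_sum _ fun p _ => (hQ p).fun_mul (hW _),
    ← Finset.sum_sub_distrib, ← Finset.sum_sub_distrib]
  refine Finset.sum_congr rfl fun p _ => ?_
  -- The derivative of the inverse metrics cancels against the transposed action on the contracted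
  -- slots.
  rw [pderiv_mul (hQ p) (hW _), hG.pderiv_prod_inv b hx, covAlong]
  ring

end IsMetricOn

end Metrics

/-! ### Covariant derivatives and contractions of formal invariants -/

section Slots

/-- Splitting off the first free slot. -/
def headSlot (k : ℕ) : Fin (k + 1) ≃ Unit ⊕ Fin k where
  toFun := Fin.cons (Sum.inl ()) Sum.inr
  invFun := Sum.elim (fun _ => 0) Fin.succ
  left_inv j := by cases j using Fin.cases <;> rfl
  right_inv j := by rcases j with _ | _ <;> rfl

/-! ### Slots of a curvature factor that acquires one more derivative -/

section DerivSlot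

variable {F : Type*} [DecidableEq F] (i : F) (o o' : F → ℕ) (hi : o' i = o i + 1)
  (h : ∀ f, f ≠ i → o' f = o f)

/-- The new positions of the slots when the factor `i` gets an additional covariant derivative. -/
def derivSlotFun : Unit ⊕ (Σ f, Fin (4 + o f)) → Σ f, Fin (4 + o' f)
  | Sum.inl _ => ⟨i, Fin.cast (by omega) (0 : Fin (4 + o i + 1))⟩
  | Sum.inr ⟨f, j⟩ =>
    if hf : f = i then ⟨f, Fin.cast (by rw [hf]; omega) j.succ⟩
    else ⟨f, Fin.cast (by rw [h _ hf]) j⟩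

theorem derivSlotFun_self (j : Fin (4 + o i)) :
    derivSlotFun i o o' hi h (Sum.inr ⟨i, j⟩) = ⟨i, Fin.cast (by omega) j.succ⟩ :=
  dif_pos rfl

theorem derivSlotFun_of_ne {f : F} (hf : f ≠ i) (j : Fin (4 + o f)) :
    derivSlotFun i o o' hi h (Sum.inr ⟨f, j⟩) = ⟨f, Fin.cast (by rw [h _ hf]) j⟩ :=
  dif_neg hf

theorem derivSlotFun_bijective : Function.Bijective (derivSlotFun i o o' hi h) := by
  constructor
  · rintro (_ | ⟨f, j⟩) (_ | ⟨f', j'⟩) hz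
    · rfl
    · by_cases hf : f' = i
      · subst hf
        rw [derivSlotFun_self] at hz
        exact absurd (congrArg (fun z : Σ f, Fin (4 + o' f) => (z.2 : ℕ)) hz)
          (Nat.succ_ne_zero _).symm
      · rw [derivSlotFun_of_ne i o o' hi h hf] at hz
        exact absurd (congrArg Sigma.fst hz).symm hf
    · by_cases hf : f = i
      · subst hf
        rw [derivSlotFun_self] at hz
        exact absurd (congrArg (fun z : Σ f, Fin (4 + o' f) => (z.2 : ℕ)) hz)
          (Nat.succ_ne_zero _)
      · rw [derivSlotFun_of_ne i o o' hi h hf] at hz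
        exact absurd (congrArg Sigma.fst hz) hf
    · by_cases hf : f = i <;> by_cases hf' : f' = i
      · subst hf
        subst hf'
        rw [derivSlotFun_self, derivSlotFun_self] at hz
        simpa using hz
      · subst hf
        rw [derivSlotFun_self, derivSlotFun_of_ne _ o o' hi h hf'] at hz
        exact absurd (congrArg Sigma.fst hz).symm hf'
      · subst hf'
        rw [derivSlotFun_self, derivSlotFun_of_ne _ o o' hi h hf] at hz
        exact absurd (congrArg Sigma.fst hz) hf
      · rw [derivSlotFun_of_ne i o o' hi h hf, derivSlotFun_of_ne i o o' hi h hf'] at hz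
        obtain rfl : f = f' := congrArg Sigma.fst hz
        simpa using hz
  · rintro ⟨f, j⟩
    by_cases hf : f = i
    · subst hf
      obtain ⟨j, rfl⟩ : ∃ j', j = Fin.cast (by omega) (j' : Fin (4 + o f + 1)) :=
        ⟨Fin.cast (by omega) j, by simp⟩
      cases j using Fin.cases with
      | zero => exact ⟨Sum.inl (), rfl⟩
      | succ j => exact ⟨Sum.inr ⟨f, j⟩, derivSlotFun_self f o o' hi h j⟩
    · exact ⟨Sum.inr ⟨f, Fin.cast (by rw [h _ hf]) j⟩, derivSlotFun_of_ne i o o' hi h hf _⟩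

/-- The slots when the factor `i` gets an additional covariant derivative. -/
noncomputable def derivSlot : Unit ⊕ (Σ f, Fin (4 + o f)) ≃ Σ f, Fin (4 + o' f) :=
  Equiv.ofBijective _ (derivSlotFun_bijective i o o' hi h)

theorem derivSlot_symm_zero :
    (derivSlot i o o' hi h).symm ⟨i, Fin.cast (by omega) (0 : Fin (4 + o i + 1))⟩ = Sum.inl () :=
  (Equiv.symm_apply_eq _).mpr rfl

theorem derivSlot_symm_succ (j : Fin (4 + o i)) :
    (derivSlot i o o' hi h).symm ⟨i, Fin.cast (by omega) j.succ⟩ = Sum.inr ⟨i, j⟩ :=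
  (Equiv.symm_apply_eq _).mpr (derivSlotFun_self i o o' hi h j).symm

theorem derivSlot_symm_of_ne {f : F} (hf : f ≠ i) (j : Fin (4 + o f)) :
    (derivSlot i o o' hi h).symm ⟨f, Fin.cast (by rw [h _ hf]) j⟩ = Sum.inr ⟨f, j⟩ :=
  (Equiv.symm_apply_eq _).mpr (derivSlotFun_of_ne i o o' hi h hf j).symm

end DerivSlot

/-- The covariant derivative acting on the curvature factor `i`. -/
noncomputable def Contraction.nabla {k : ℕ} (C : Contraction k) (i : Fin C.numCurv) : Contraction (k + 1) where
  numCurv := C.numCurv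
  order := C.order + Pi.single i 1
  numMetric := C.numMetric
  numPairs := C.numPairs
  slots := ((headSlot k).sumCongr (Equiv.refl _)).trans <| (Equiv.sumAssoc _ _ _).trans <|
    ((Equiv.refl Unit).sumCongr C.slots).trans <| (Equiv.sumAssoc _ _ _).symm.trans <|
    (derivSlot i C.order _ (by simp) (by simp +contextual)).sumCongr (Equiv.refl _)

/-- The contraction of further pairs of free slots. -/
def Contraction.contract {k k' m : ℕ} (C : Contraction k) (e : Fin k ≃ Fin k' ⊕ (Fin m × Fin 2)) :
    Contraction k' where
  numCurv := C.numCurv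
  order := C.order
  numMetric := C.numMetric
  numPairs := m + C.numPairs
  slots := ((Equiv.refl _).sumCongr ((finSumFinEquiv.symm.prodCongr (Equiv.refl _)).trans
    (Equiv.sumProdDistrib _ _ _))).trans <| (Equiv.sumAssoc _ _ _).symm.trans <|
    (e.symm.sumCongr (Equiv.refl _)).trans C.slots

end Slots

/-! ### Evaluating the formal operations at a metric -/

section Formal

variable {E ι : Type*} [NormedAddCommGroup E] [NormedSpace ℝ E] [Fintype ι] [DecidableEq ι]
  (b : Module.Basis ι ℝ E) {k : ℕ}

/-- The product of the curvature factors and metric factors before contraction. -/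
noncomputable def Contraction.body (C : Contraction k) (G : E → Matrix ι ι ℝ) (x : E)
    (r : (Σ i : Fin C.numCurv, Fin (4 + C.order i)) ⊕ (Fin C.numMetric × Fin 2) → ι) : ℝ :=
  (∏ i, nablaRiemann b G (C.order i) x fun j => (r ∘ Sum.inl) ⟨i, j⟩) *
    ∏ m, G x ((r ∘ Sum.inr) (m, 0)) ((r ∘ Sum.inr) (m, 1))

theorem Contraction.comp_eq_sum_body (C : Contraction k) (G : E → Matrix ι ι ℝ) (x : E)
    (a : Fin k → ι) :
    C.comp b G x a = ∑ p : Fin C.numPairs × Fin 2 → ι,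
      (∏ s, (G x)⁻¹ (p (s, 0)) (p (s, 1))) * C.body b G x (Sum.elim a p ∘ C.slots.symm) := by
  simp only [Contraction.comp, Contraction.body, mul_assoc, Function.comp_apply]

/-- The pairs of `C.contract e` are the `m` new ones followed by those of `C`, so a sum over index
functions on all pairs is a double sum, and the product of inverse metrics splits accordingly. -/
theorem Contraction.comp_contract {k' m : ℕ} (C : Contraction k)
    (e : Fin k ≃ Fin k' ⊕ (Fin m × Fin 2)) (G : E → Matrix ι ι ℝ) (x : E) (a : Fin k' → ι) :
    (C.contract e).comp b G x a = ∑ p : Fin m × Fin 2 → ι,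
      (∏ s, (G x)⁻¹ (p (s, 0)) (p (s, 1))) * C.comp b G x (Sum.elim a p ∘ e) := by
  simp only [Contraction.comp_eq_sum_body, Finset.mul_sum]
  rw [← Fintype.sum_prod_type']
  let ε : (Fin (m + C.numPairs) × Fin 2 → ι) ≃
      (Fin m × Fin 2 → ι) × (Fin C.numPairs × Fin 2 → ι) :=
    (Equiv.arrowCongr ((finSumFinEquiv.symm.prodCongr (Equiv.refl (Fin 2))).trans
      (Equiv.sumProdDistrib _ _ _)) (Equiv.refl ι)).trans (Equiv.sumArrowEquivProdArrow _ _ _)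
  refine Fintype.sum_equiv ε _ _ fun p => ?_
  rw [← mul_assoc]
  congr 1
  · exact Fin.prod_univ_add _
  · change C.body b G x _ = C.body b G x _
    congr 1
    have h : ∀ z, Sum.elim a p (((Equiv.refl _).sumCongr ((finSumFinEquiv.symm.prodCongr
        (Equiv.refl _)).trans (Equiv.sumProdDistrib _ _ _))).symm (Equiv.sumAssoc _ _ _
        ((e.symm.sumCongr (Equiv.refl _)).symm z)))
        = Sum.elim (Sum.elim a (ε p).1 ∘ e) (ε p).2 z := by
      rintro (z | z)
      · rcases hz : e z with y | y
        · simp [ε, hz]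
        · simp [ε, hz]
      · simp [ε]
    exact funext fun z => h (C.slots.symm z)

/-- The order of a factor after differentiation is known only up to a propositional equality, so its
indices have to be transported along `Fin.cast`. -/
theorem nablaRiemann_cast (G : E → Matrix ι ι ℝ) (x : E) {N N' : ℕ} (h : N = N')
    (v : Fin (4 + N) → ι) :
    nablaRiemann b G N x v = nablaRiemann b G N' x (v ∘ Fin.cast (by rw [h])) := by
  subst h
  rfl

/-- Factor `i` has order `o i + 1` and is by definition a covariant derivative whose first slot is
the new one, filled with `c`. All other factors only have their indices relabelled. -/
theorem prod_nablaRiemann_derivSlot {F : Type*} [Fintype F] [DecidableEq F] (i : F) (o o' : F → ℕ)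
    (hi : o' i = o i + 1) (h : ∀ f, f ≠ i → o' f = o f) (G : E → Matrix ι ι ℝ) (x : E) (c : ι)
    (r : (Σ f, Fin (4 + o f)) → ι) :
    ∏ f, nablaRiemann b G (o' f) x
        (fun j => Sum.elim (fun _ => c) r ((derivSlot i o o' hi h).symm ⟨f, j⟩))
      = covAlong b G c (nablaRiemann b G (o i)) x (fun j => r ⟨i, j⟩)
        * ∏ f ∈ Finset.univ.erase i, nablaRiemann b G (o f) x fun j => r ⟨f, j⟩ := by
  rw [← Finset.mul_prod_erase Finset.univ _ (Finset.mem_univ i)]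
  congr 1
  · rw [nablaRiemann_cast b G x hi, nablaRiemann, covDeriv_eq_covAlong]
    congr 1
    · exact congrArg (Sum.elim (fun _ => c) r) (derivSlot_symm_zero i o o' hi h)
    · exact funext fun j => congrArg (Sum.elim (fun _ => c) r) (derivSlot_symm_succ i o o' hi h j)
  · refine Finset.prod_congr rfl fun f hf => ?_
    have hf' := Finset.ne_of_mem_erase hf
    rw [nablaRiemann_cast b G x (h f hf')]
    congr 1
    exact funext fun j =>
      congrArg (Sum.elim (fun _ => c) r) (derivSlot_symm_of_ne i o o' hi h hf' j)

/-- Unwinding the slot bijection: the first free index feeds the new derivative slot of factor `i`,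
and every other slot reads the index it read in `C`. The right side is one term of the Leibniz rule
in `Contraction.covAlong_body`. -/
theorem Contraction.body_nabla (C : Contraction k) (i : Fin C.numCurv) (G : E → Matrix ι ι ℝ)
    (x : E) (a : Fin (k + 1) → ι) (p : Fin C.numPairs × Fin 2 → ι) :
    (C.nabla i).body b G x (Sum.elim a p ∘ (C.nabla i).slots.symm)
      = covAlong b G (a 0) (nablaRiemann b G (C.order i)) x
          (fun j => Sum.elim (Fin.tail a) p (C.slots.symm (Sum.inl ⟨i, j⟩)))
        * (∏ i' ∈ Finset.univ.erase i, nablaRiemann b G (C.order i') x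
          fun j => Sum.elim (Fin.tail a) p (C.slots.symm (Sum.inl ⟨i', j⟩)))
        * ∏ m, G x (Sum.elim (Fin.tail a) p (C.slots.symm (Sum.inr (m, 0))))
          (Sum.elim (Fin.tail a) p (C.slots.symm (Sum.inr (m, 1)))) := by
  have hr : ∀ z, Sum.elim a p (((headSlot k).sumCongr (Equiv.refl _)).symm
      ((Equiv.sumAssoc _ _ _).symm (((Equiv.refl Unit).sumCongr C.slots).symm z)))
      = Sum.elim (fun _ => a 0) (fun z => Sum.elim (Fin.tail a) p (C.slots.symm z)) z := by
    rintro (z | z)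
    · simp [headSlot]
    · simp only [Equiv.sumCongr_symm, Equiv.sumCongr_apply, Sum.map_inr, Sum.elim_inr]
      rcases C.slots.symm z with y | y
      · simp [headSlot, Fin.tail]
      · simp
  refine congrArg₂ (· * ·) ?_ ?_
  · refine Eq.trans ?_ (prod_nablaRiemann_derivSlot b i C.order (C.nabla i).order
      (by simp [Contraction.nabla]) (by simp +contextual [Contraction.nabla]) G x (a 0)
      fun z => Sum.elim (Fin.tail a) p (C.slots.symm (Sum.inl z)))
    refine Finset.prod_congr rfl fun f _ => congrArg _ (funext fun j => ?_)
    have hy : ∀ y : Unit ⊕ (Σ f, Fin (4 + C.order f)),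
        Sum.elim (fun _ => a 0) (fun z => Sum.elim (Fin.tail a) p (C.slots.symm z))
        (Equiv.sumAssoc _ _ _ (Sum.inl y)) = Sum.elim (fun _ => a 0)
          (fun z => Sum.elim (Fin.tail a) p (C.slots.symm (Sum.inl z))) y := by
      rintro (_ | _) <;> rfl
    exact (hr _).trans (hy _)
  · refine Finset.prod_congr rfl fun m _ => ?_
    exact congrArg₂ (G x) (hr (Sum.inr (Sum.inr (m, 0)))) (hr (Sum.inr (Sum.inr (m, 1))))

end Formal

/-! ### The Leibniz rule for formal invariants -/

section FormalDerivative

variable {E ι : Type*} [NormedAddCommGroup E] [NormedSpace ℝ E] [Fintype ι] [DecidableEq ι]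
  {b : Module.Basis ι ℝ E} {k : ℕ} {G : E → Matrix ι ι ℝ} {U : Set E}

theorem Contraction.isSmooth_body (C : Contraction k) (hG : IsMetricOn G U) :
    IsSmoothTensorOn (C.body b G) U := fun _ x hx =>
  (contDiffAt_prod fun i _ => hG.isSmooth_nablaRiemann b (C.order i) _ x hx).mul
    (contDiffAt_prod fun _ _ => hG.smooth _ _ x hx)

theorem Contraction.isSmooth_comp (C : Contraction k) (hG : IsMetricOn G U) :
    IsSmoothTensorOn (C.comp b G) U := fun a x hx => by
  simp only [Contraction.comp_eq_sum_body]
  exact ContDiffAt.sum fun p _ => (contDiffAt_prod fun _ _ => hG.contDiffAt_inv hx _ _).mul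
    (C.isSmooth_body hG _ x hx)

/-- Leibniz rule; since `∇g = 0`, only the curvature factors contribute. -/
theorem Contraction.covAlong_body (C : Contraction k) (hG : IsMetricOn G U) {x : E} (hx : x ∈ U)
    (i : ι) (r : (Σ i : Fin C.numCurv, Fin (4 + C.order i)) ⊕ (Fin C.numMetric × Fin 2) → ι) :
    covAlong b G i (C.body b G) x r
      = ∑ f, covAlong b G i (nablaRiemann b G (C.order f)) x (fun j => r (Sum.inl ⟨f, j⟩))
        * (∏ f' ∈ Finset.univ.erase f, nablaRiemann b G (C.order f') x
          fun j => r (Sum.inl ⟨f', j⟩))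
        * ∏ m, G x (r (Sum.inr (m, 0))) (r (Sum.inr (m, 1))) := by
  have h := covAlong_mul b G i (x := x)
    (V := fun y (r : (Σ i : Fin C.numCurv, Fin (4 + C.order i)) → ι) =>
      ∏ f, nablaRiemann b G (C.order f) y fun j => r ⟨f, j⟩)
    (W := fun y (r : Fin C.numMetric × Fin 2 → ι) => ∏ m, G y (r (m, 0)) (r (m, 1)))
    (fun a => differentiableAt_of_contDiffAt
      (contDiffAt_prod fun f _ => hG.isSmooth_nablaRiemann b (C.order f) _ x hx))
    (fun a => differentiableAt_of_contDiffAt (contDiffAt_prod fun _ _ => hG.smooth _ _ x hx)) r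
  refine h.trans ?_
  rw [hG.covAlong_prod_metric b hx, mul_zero, add_zero, covAlong_prod b G i fun f a =>
    differentiableAt_of_contDiffAt (hG.isSmooth_nablaRiemann b (C.order f) a x hx), Finset.sum_mul]
  rfl

/-- The derivative passes through the contractions and then distributes over the curvature factors.
This is why formal invariants are closed under `∇`. -/
theorem Contraction.covDeriv_comp (C : Contraction k) (hG : IsMetricOn G U) {x : E} (hx : x ∈ U)
    (a : Fin (k + 1) → ι) :
    covDeriv b G (C.comp b G) x a = ∑ i, (C.nabla i).comp b G x a := by
  have hC : C.comp b G = fun y r => ∑ p : Fin C.numPairs × Fin 2 → ι,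
      (∏ s, (G y)⁻¹ (p (s, 0)) (p (s, 1)))
        * (fun z q => C.body b G z (q ∘ C.slots.symm)) y (Sum.elim r p) :=
    funext fun y => funext fun r => C.comp_eq_sum_body b G y r
  rw [covDeriv_eq_covAlong, hC, hG.covAlong_contract b hx _
    (W := fun z q => C.body b G z (q ∘ C.slots.symm)) fun q =>
      differentiableAt_of_contDiffAt (C.isSmooth_body hG _ x hx)]
  simp only [Contraction.comp_eq_sum_body, covAlong_reindex, C.covAlong_body hG hx]
  refine Eq.trans ?_ (Finset.sum_comm (s := Finset.univ (α := Fin C.numPairs × Fin 2 → ι))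
    (f := fun p i => (∏ s, (G x)⁻¹ (p (s, 0)) (p (s, 1)))
      * (C.nabla i).body b G x (Sum.elim a p ∘ (C.nabla i).slots.symm)))
  refine Finset.sum_congr rfl fun p _ => ?_
  rw [Finset.mul_sum]
  refine Finset.sum_congr rfl fun i _ => ?_
  exact congrArg _ (C.body_nabla b i G x a p).symm

/-! ### Linear combinations -/

/-- Evaluation at a fixed metric, point and index is a linear functional of the formal combination.
-/
theorem TensorInvariant.comp_linearCombination {k' : ℕ} (f : Contraction k → TensorInvariant k')
    (T : TensorInvariant k) (x : E) (a : Fin k' → ι) :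
    TensorInvariant.comp (Finsupp.linearCombination ℝ f T) b G x a
      = T.sum fun C c => c * (f C).comp b G x a :=
  Finsupp.apply_linearCombination ℝ
    (Finsupp.linearCombination ℝ fun C : Contraction k' => C.comp b G x a) f T

theorem TensorInvariant.comp_sum_single {k' : ℕ} {α : Type*} (s : Finset α) (f : α → Contraction k')
    (x : E) (a : Fin k' → ι) :
    TensorInvariant.comp (∑ i ∈ s, Finsupp.single (f i) 1) b G x a
      = ∑ i ∈ s, (f i).comp b G x a := by
  refine (map_sum (Finsupp.linearCombination ℝ fun C : Contraction k' => C.comp b G x a) _ _).trans ?_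
  simp

theorem TensorInvariant.comp_add_smul (T T' : TensorInvariant k) (c : ℝ) (x : E) (a : Fin k → ι) :
    (T + c • T').comp b G x a = T.comp b G x a + c * T'.comp b G x a := by
  have h := map_add (Finsupp.linearCombination ℝ fun C : Contraction k => C.comp b G x a) T (c • T')
  rw [map_smul] at h
  exact h

/-- The covariant derivative of a formal invariant. -/
noncomputable def TensorInvariant.nabla (T : TensorInvariant k) : TensorInvariant (k + 1) :=
  Finsupp.linearCombination ℝ (fun C => ∑ i, Finsupp.single (C.nabla i) 1) T

/-- The contraction of pairs of free slots of a formal invariant. -/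
noncomputable def TensorInvariant.contract {k' m : ℕ} (e : Fin k ≃ Fin k' ⊕ (Fin m × Fin 2))
    (T : TensorInvariant k) : TensorInvariant k' :=
  Finsupp.linearCombination ℝ (fun C => Finsupp.single (C.contract e) 1) T

theorem TensorInvariant.isSmooth_comp (T : TensorInvariant k) (hG : IsMetricOn G U) :
    IsSmoothTensorOn (T.comp b G) U := fun a x hx =>
  ContDiffAt.sum fun C _ => contDiffAt_const.mul (C.isSmooth_comp hG a x hx)

theorem TensorInvariant.covDeriv_comp (T : TensorInvariant k) (hG : IsMetricOn G U) {x : E}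
    (hx : x ∈ U) (a : Fin (k + 1) → ι) :
    covDeriv b G (T.comp b G) x a = T.nabla.comp b G x a := by
  have hd : ∀ (C : Contraction k) r, DifferentiableAt ℝ (fun y => C.comp b G y r) x := fun C r =>
    differentiableAt_of_contDiffAt (C.isSmooth_comp hG r x hx)
  rw [TensorInvariant.nabla, TensorInvariant.comp_linearCombination]
  simp only [TensorInvariant.comp_sum_single, ← Contraction.covDeriv_comp _ hG hx]
  simp only [covDeriv_eq_covAlong, covAlong, TensorInvariant.comp, Finsupp.sum]
  rw [pderiv_sum _ fun C _ => (hd C _).const_mul _]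
  simp only [pderiv_const_mul _ (hd _ _), mul_sub, Finset.sum_sub_distrib]
  congr 1
  exact slotAction_sum_mul _ T.support _ _ _

theorem TensorInvariant.comp_contract {k' m : ℕ} (e : Fin k ≃ Fin k' ⊕ (Fin m × Fin 2))
    (T : TensorInvariant k) (x : E) (a : Fin k' → ι) :
    (T.contract e).comp b G x a = ∑ p : Fin m × Fin 2 → ι,
      (∏ s, (G x)⁻¹ (p (s, 0)) (p (s, 1))) * T.comp b G x (Sum.elim a p ∘ e) := by
  rw [TensorInvariant.contract, TensorInvariant.comp_linearCombination]
  have h : ∀ C : Contraction k, TensorInvariant.comp (Finsupp.single (C.contract e) 1) b G x a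
      = (C.contract e).comp b G x a := fun C => by
    simpa using TensorInvariant.comp_sum_single (b := b) (G := G) {()} (fun _ => C.contract e) x a
  simp only [h, Contraction.comp_contract]
  simp only [TensorInvariant.comp, Finsupp.sum, Finset.mul_sum]
  rw [Finset.sum_comm]
  exact Finset.sum_congr rfl fun p _ => Finset.sum_congr rfl fun C _ => by ring

end FormalDerivative

/-! ### The invariant `∇^a ∇^b T_{ab} + c Δ T_b{}^b` -/

section DoubleDivergence

/-- The two slots of a tensor of rank `2` as a contracted pair. -/
def pairSlots : Fin 2 ≃ Fin 0 ⊕ (Fin 1 × Fin 2) where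
  toFun := ![Sum.inr (0, 0), Sum.inr (0, 1)]
  invFun := Sum.elim Fin.elim0 Prod.snd
  left_inv := by decide
  right_inv := by decide

/-- The contracted pairs of slots in `∇^a ∇^b T_{ab}`. -/
def doubleDivSlots : Fin 4 ≃ Fin 0 ⊕ (Fin 2 × Fin 2) where
  toFun := ![Sum.inr (0, 1), Sum.inr (1, 1), Sum.inr (0, 0), Sum.inr (1, 0)]
  invFun := Sum.elim Fin.elim0 fun z => ![![2, 0], ![3, 1]] z.1 z.2
  left_inv := by decide
  right_inv := by decide

/-- The slots of `∇_q U_{ij}` with the pair `q`, `j` contracted. -/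
def divSlots : Fin 3 ≃ Fin 1 ⊕ (Fin 1 × Fin 2) where
  toFun := ![Sum.inr (0, 1), Sum.inl 0, Sum.inr (0, 0)]
  invFun := Sum.elim (fun _ => 1) fun z => ![2, 0] z.2
  left_inv := by decide
  right_inv := by decide

variable {ι : Type*} [Fintype ι]

theorem sum_pair_indices (f : (Fin 1 × Fin 2 → ι) → ℝ) :
    ∑ p, f p = ∑ i, ∑ j, f fun z => ![i, j] z.2 := by
  rw [← Fintype.sum_prod_type' (f := fun i j => f fun z => ![i, j] z.2)]
  let ε : (Fin 1 × Fin 2 → ι) ≃ ι × ι :=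
    { toFun := fun p => (p (0, 0), p (0, 1))
      invFun := fun y z => ![y.1, y.2] z.2
      left_inv := fun p => by
        ext ⟨a, c⟩
        fin_cases a; fin_cases c <;> rfl
      right_inv := fun _ => rfl }
  exact Fintype.sum_equiv ε _ _ fun p => congrArg f (ε.left_inv p).symm

theorem sum_two_pair_indices (f : (Fin 2 × Fin 2 → ι) → ℝ) :
    ∑ p, f p = ∑ i, ∑ j, ∑ p, ∑ q, f fun z => ![![i, p], ![j, q]] z.1 z.2 := by
  have h : ∀ i j, ∑ p, ∑ q, f (fun z => ![![i, p], ![j, q]] z.1 z.2)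
      = ∑ y : ι × ι, f fun z => ![![i, y.1], ![j, y.2]] z.1 z.2 := fun i j =>
    (Fintype.sum_prod_type' (f := fun p q => f fun z => ![![i, p], ![j, q]] z.1 z.2)).symm
  simp only [h]
  rw [← Fintype.sum_prod_type'
      (f := fun i j => ∑ y : ι × ι, f fun z => ![![i, y.1], ![j, y.2]] z.1 z.2),
    ← Fintype.sum_prod_type'
      (f := fun (x y : ι × ι) => f fun z => ![![x.1, y.1], ![x.2, y.2]] z.1 z.2)]
  let ε : (Fin 2 × Fin 2 → ι) ≃ (ι × ι) × (ι × ι) :=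
    { toFun := fun p => ((p (0, 0), p (1, 0)), (p (0, 1), p (1, 1)))
      invFun := fun y z => ![![y.1.1, y.2.1], ![y.1.2, y.2.2]] z.1 z.2
      left_inv := fun p => by
        ext ⟨a, c⟩
        fin_cases a <;> fin_cases c <;> rfl
      right_inv := fun _ => rfl }
  exact Fintype.sum_equiv ε _ _ fun p => congrArg f (ε.left_inv p).symm

variable {E : Type*} [NormedAddCommGroup E] [NormedSpace ℝ E] [DecidableEq ι]
  {b : Module.Basis ι ℝ E} {G : E → Matrix ι ι ℝ} {U : Set E}

theorem covDeriv_congr {k : ℕ} {T T' : E → (Fin k → ι) → ℝ} (hU : IsOpen U)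
    (h : ∀ y ∈ U, ∀ a, T y a = T' y a) {x : E} (hx : x ∈ U) (a : Fin (k + 1) → ι) :
    covDeriv b G T x a = covDeriv b G T' x a := by
  have hx' : T x = T' x := funext (h x hx)
  rw [covDeriv_eq_covAlong, covDeriv_eq_covAlong, covAlong, covAlong, hx',
    pderiv_congr (Filter.mem_of_superset (hU.mem_nhds hx) fun y hy => h y hy _)]

theorem TensorInvariant.comp_contract_pairSlots (T : TensorInvariant 2) (x : E) (a : Fin 0 → ι) :
    (T.contract pairSlots).comp b G x a = trace₂ G (T.comp b G) x a := by
  rw [TensorInvariant.comp_contract, sum_pair_indices, trace₂]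
  refine Finset.sum_congr rfl fun i _ => Finset.sum_congr rfl fun j _ => ?_
  refine congrArg₂ (· * ·) (by simp) (congrArg _ ?_)
  ext z
  fin_cases z <;> rfl

/-- The formal invariant `∇^a ∇^b T_{ab} + c Δ T_b{}^b`. -/
noncomputable def TensorInvariant.doubleDivAddLaplacianTrace (T : TensorInvariant 2) (c : ℝ) :
    TensorInvariant 0 :=
  T.nabla.nabla.contract doubleDivSlots
    + c • (T.contract pairSlots).nabla.nabla.contract pairSlots

theorem TensorInvariant.comp_doubleDivAddLaplacianTrace (T : TensorInvariant 2) (c : ℝ)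
    (hG : IsMetricOn G U) {x : E} (hx : x ∈ U) (a : Fin 0 → ι) :
    (T.doubleDivAddLaplacianTrace c).comp b G x a
      = doubleDiv b G (T.comp b G) x + c * laplacian b G (trace₂ G (T.comp b G)) x := by
  rw [TensorInvariant.doubleDivAddLaplacianTrace, TensorInvariant.comp_add_smul]
  have h2 : ∀ {k : ℕ} (S : TensorInvariant k) r,
      S.nabla.nabla.comp b G x r = covDeriv b G (covDeriv b G (S.comp b G)) x r := fun S r => by
    rw [← TensorInvariant.covDeriv_comp _ hG hx]
    -- The first derivative is known to be formal only on `U`, which suffices for differentiating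
    -- again because `U` is open.
    exact covDeriv_congr hG.isOpen (fun y hy a => (S.covDeriv_comp hG hy a).symm) hx r
  have h0 : (T.contract pairSlots).comp b G = trace₂ G (T.comp b G) :=
    funext fun y => funext fun a => T.comp_contract_pairSlots y a
  congr 1
  · rw [TensorInvariant.comp_contract, sum_two_pair_indices, doubleDiv]
    refine Finset.sum_congr rfl fun i _ => Finset.sum_congr rfl fun j _ =>
      Finset.sum_congr rfl fun p _ => Finset.sum_congr rfl fun q _ => ?_
    rw [h2]
    refine congrArg₂ (· * ·) (by simp [Fin.prod_univ_two]) (congrArg _ ?_)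
    ext z
    fin_cases z <;> rfl
  · rw [TensorInvariant.comp_contract, sum_pair_indices, laplacian]
    congr 1
    refine Finset.sum_congr rfl fun i _ => Finset.sum_congr rfl fun j _ => ?_
    rw [h2, h0]
    refine congrArg₂ (· * ·) (by simp) (congrArg _ ?_)
    ext z
    fin_cases z <;> rfl

/-- The divergence `∇^a V_a`. -/
noncomputable def divergence (b : Module.Basis ι ℝ E) (G : E → Matrix ι ι ℝ)
    (V : E → (Fin 1 → ι) → ℝ) (x : E) : ℝ :=
  ∑ i, ∑ p, (G x)⁻¹ i p * covDeriv b G V x ![i, p]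

/-- The divergence `∇^b T_{ab}`. -/
noncomputable def divergence₂ (b : Module.Basis ι ℝ E) (G : E → Matrix ι ι ℝ)
    (T : E → (Fin 2 → ι) → ℝ) (x : E) (a : Fin 1 → ι) : ℝ :=
  ∑ j, ∑ q, (G x)⁻¹ j q * covDeriv b G T x ![q, a 0, j]

theorem laplacian_eq_divergence (f : E → (Fin 0 → ι) → ℝ) (x : E) :
    laplacian b G f x = divergence b G (covDeriv b G f) x := rfl

/-- The outer derivative commutes with the inner contraction. With this, both terms of the invariant
become divergences of 1-forms, to which one ambient formula applies. -/
theorem doubleDiv_eq_divergence {T : E → (Fin 2 → ι) → ℝ} (hG : IsMetricOn G U)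
    (hT : IsSmoothTensorOn T U) {x : E} (hx : x ∈ U) :
    doubleDiv b G T x = divergence b G (divergence₂ b G T) x := by
  have h : ∀ p i, covDeriv b G (divergence₂ b G T) x ![p, i]
      = ∑ j, ∑ q, (G x)⁻¹ j q * covDeriv b G (covDeriv b G T) x ![p, q, i, j] := by
    intro p i
    have hd : divergence₂ b G T = fun y r => ∑ p : Fin 1 × Fin 2 → ι,
        (∏ s, (G y)⁻¹ (p (s, 0)) (p (s, 1)))
          * (fun z q => covDeriv b G T z (q ∘ divSlots)) y (Sum.elim r p) := by
      funext y r
      rw [sum_pair_indices, divergence₂]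
      refine Finset.sum_congr rfl fun i _ => Finset.sum_congr rfl fun j _ => ?_
      refine congrArg₂ (· * ·) (by simp) (congrArg _ ?_)
      ext z
      fin_cases z <;> rfl
    rw [covDeriv_eq_covAlong, hd, hG.covAlong_contract b hx _
      (W := fun z q => covDeriv b G T z (q ∘ divSlots)) fun q =>
        differentiableAt_of_contDiffAt (hG.isSmooth_covDeriv b hT _ x hx), sum_pair_indices]
    refine Finset.sum_congr rfl fun j _ => Finset.sum_congr rfl fun q _ => ?_
    refine congrArg₂ (· * ·) (by simp) ?_
    rw [covAlong_reindex, covDeriv_eq_covAlong]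
    congr 1
    ext z
    fin_cases z <;> rfl
  simp only [doubleDiv, divergence, h, Finset.mul_sum]
  refine Eq.trans (Finset.sum_congr rfl fun i _ => Finset.sum_comm) (Finset.sum_comm.trans ?_)
  refine Finset.sum_congr rfl fun p _ => Finset.sum_congr rfl fun i _ =>
    Finset.sum_congr rfl fun j _ => Finset.sum_congr rfl fun q _ => ?_
  rw [hG.inv_symm hx i p, mul_assoc]

end DoubleDivergence

/-! ### Constant rescalings of the metric -/

section Rescaling

variable {E ι : Type*} [NormedAddCommGroup E] [NormedSpace ℝ E] [Fintype ι] [DecidableEq ι]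
  {b : Module.Basis ι ℝ E} {G : E → Matrix ι ι ℝ} {U : Set E} {s : ℝ} {k : ℕ}

theorem IsMetricOn.inv_smul (hG : IsMetricOn G U) (hs : s ≠ 0) {x : E} (hx : x ∈ U) (i j : ι) :
    (s • G x)⁻¹ i j = s⁻¹ * (G x)⁻¹ i j := by
  have h := Matrix.inv_smul' (A := G x) (Units.mk0 s hs)
    (isUnit_iff_ne_zero.mpr (hG.det_ne_zero x hx))
  exact congrFun (congrFun h i) j

/-- The constant comes out of the derivatives and cancels against the inverse metric. -/
theorem IsMetricOn.christoffel_smul (hG : IsMetricOn G U) (hs : s ≠ 0) {x : E} (hx : x ∈ U)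
    (i j l : ι) :
    christoffel b (fun y => s • G y) i j l x = christoffel b G i j l x := by
  have hd : ∀ i j m, pderiv b i (fun y => (s • G y) j m) x = s * pderiv b i (fun y => G y j m) x :=
    fun i j m => pderiv_const_mul s (differentiableAt_of_contDiffAt (hG.smooth j m x hx))
  simp only [christoffel, hd, hG.inv_smul hs hx]
  congr 1
  refine Finset.sum_congr rfl fun m _ => ?_
  field_simp

theorem IsMetricOn.covDeriv_smul (hG : IsMetricOn G U) (hs : s ≠ 0) {x : E} (hx : x ∈ U)
    (T : E → (Fin k → ι) → ℝ) (a : Fin (k + 1) → ι) :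
    covDeriv b (fun y => s • G y) T x a = covDeriv b G T x a := by
  simp only [covDeriv, hG.christoffel_smul hs hx]

theorem covDeriv_const_mul {T : E → (Fin k → ι) → ℝ} (hT : IsSmoothTensorOn T U) (v : ℝ) {x : E}
    (hx : x ∈ U) (a : Fin (k + 1) → ι) :
    covDeriv b G (fun y r => v * T y r) x a = v * covDeriv b G T x a := by
  simp only [covDeriv, pderiv_const_mul v (differentiableAt_of_contDiffAt (hT _ x hx)), mul_sub,
    Finset.mul_sum]
  congr 1
  exact Finset.sum_congr rfl fun _ _ => Finset.sum_congr rfl fun _ _ => by ring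

theorem IsMetricOn.covDeriv_covDeriv_smul (hG : IsMetricOn G U) (hs : s ≠ 0) {v : ℝ}
    {T T' : E → (Fin k → ι) → ℝ} (hT : IsSmoothTensorOn T U)
    (h : ∀ y ∈ U, ∀ a, T' y a = v * T y a) {x : E} (hx : x ∈ U) (a : Fin (k + 1 + 1) → ι) :
    covDeriv b (fun y => s • G y) (covDeriv b (fun y => s • G y) T') x a
      = v * covDeriv b G (covDeriv b G T) x a := by
  rw [hG.covDeriv_smul hs hx, ← covDeriv_const_mul (hG.isSmooth_covDeriv b hT) v hx]
  refine covDeriv_congr hG.isOpen (fun y hy r => ?_) hx a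
  rw [hG.covDeriv_smul hs hy, ← covDeriv_const_mul hT v hy]
  exact covDeriv_congr hG.isOpen h hy r

theorem IsMetricOn.doubleDiv_smul (hG : IsMetricOn G U) (hs : s ≠ 0) {v : ℝ}
    {T T' : E → (Fin 2 → ι) → ℝ} (hT : IsSmoothTensorOn T U)
    (h : ∀ y ∈ U, ∀ a, T' y a = v * T y a) {x : E} (hx : x ∈ U) :
    doubleDiv b (fun y => s • G y) T' x = s⁻¹ * s⁻¹ * v * doubleDiv b G T x := by
  simp only [doubleDiv, hG.covDeriv_covDeriv_smul hs hT h hx, hG.inv_smul hs hx, Finset.mul_sum]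
  exact Finset.sum_congr rfl fun _ _ => Finset.sum_congr rfl fun _ _ =>
    Finset.sum_congr rfl fun _ _ => Finset.sum_congr rfl fun _ _ => by ring

theorem IsMetricOn.isSmooth_trace₂ (hG : IsMetricOn G U) {T : E → (Fin 2 → ι) → ℝ}
    (hT : IsSmoothTensorOn T U) : IsSmoothTensorOn (trace₂ G T) U := fun _ x hx =>
  ContDiffAt.sum fun _ _ => ContDiffAt.sum fun _ _ => (hG.contDiffAt_inv hx _ _).mul (hT _ x hx)

/-- One factor `s⁻¹` comes from the trace, the other from the Laplacian, so the scaling agrees with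
that of the double divergence. -/
theorem IsMetricOn.laplacian_trace₂_smul (hG : IsMetricOn G U) (hs : s ≠ 0) {v : ℝ}
    {T T' : E → (Fin 2 → ι) → ℝ} (hT : IsSmoothTensorOn T U)
    (h : ∀ y ∈ U, ∀ a, T' y a = v * T y a) {x : E} (hx : x ∈ U) :
    laplacian b (fun y => s • G y) (trace₂ (fun y => s • G y) T') x
      = s⁻¹ * s⁻¹ * v * laplacian b G (trace₂ G T) x := by
  have h' : ∀ y ∈ U, ∀ a, trace₂ (fun y => s • G y) T' y a = s⁻¹ * v * trace₂ G T y a := by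
    intro y hy a
    simp only [trace₂, h y hy, hG.inv_smul hs hy, Finset.mul_sum]
    exact Finset.sum_congr rfl fun _ _ => Finset.sum_congr rfl fun _ _ => by ring
  simp only [laplacian, hG.covDeriv_covDeriv_smul hs (hG.isSmooth_trace₂ hT) h' hx,
    hG.inv_smul hs hx, Finset.mul_sum]
  exact Finset.sum_congr rfl fun _ _ => Finset.sum_congr rfl fun _ _ => by ring

end Rescaling

/-! ### Metrics on manifolds in coordinates -/

section ManifoldMetrics

variable {n : ℕ} {M : Type u} [TopologicalSpace M] [ChartedSpace (EuclideanSpace ℝ (Fin n)) M]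
  {e : OpenPartialHomeomorph M (EuclideanSpace ℝ (Fin n))}

theorem mdifferentiableAt_extend_symm (he : e ∈ IsManifold.maximalAtlas (𝓡 n) ∞ M)
    {x : EuclideanSpace ℝ (Fin n)} (hx : x ∈ (e.extend (𝓡 n)).target) :
    MDifferentiableAt 𝓘(ℝ, EuclideanSpace ℝ (Fin n)) (𝓡 n) (e.extend (𝓡 n)).symm x := by
  have h := contMDiffOn_extend_symm he
  have ho : IsOpen ((𝓡 n) '' e.target) := by
    rw [← e.extend_target']
    exact e.isOpen_extend_target
  rw [e.extend_target'] at hx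
  exact (h.contMDiffAt (ho.mem_nhds hx)).mdifferentiableAt (by simp)

/-- The differential of the chart is a left inverse, by the chain rule. -/
theorem coordVec_injective (he : e ∈ IsManifold.maximalAtlas (𝓡 n) ∞ M)
    {x : EuclideanSpace ℝ (Fin n)} (hx : x ∈ (e.extend (𝓡 n)).target) :
    Function.Injective (coordVec (𝓡 n) e x) := by
  have hp : (e.extend (𝓡 n)).symm x ∈ e.source := by
    rw [← e.extend_source (I := 𝓡 n)]
    exact (e.extend (𝓡 n)).map_target hx
  have h1 : MDifferentiableAt (𝓡 n) 𝓘(ℝ, EuclideanSpace ℝ (Fin n)) (e.extend (𝓡 n))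
      ((e.extend (𝓡 n)).symm x) :=
    (e.contMDiffAt_extend he hp).mdifferentiableAt (by simp)
  have h2 := mfderiv_comp x h1 (mdifferentiableAt_extend_symm he hx)
  have h3 : (e.extend (𝓡 n)) ∘ (e.extend (𝓡 n)).symm =ᶠ[nhds x] id :=
    Filter.mem_of_superset (e.isOpen_extend_target.mem_nhds hx)
      fun y hy => (e.extend (𝓡 n)).right_inv hy
  rw [h3.mfderiv_eq, mfderiv_id] at h2
  intro v w hvw
  have h4 : ∀ v, mfderiv (𝓡 n) 𝓘(ℝ, EuclideanSpace ℝ (Fin n)) (e.extend (𝓡 n))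
      ((e.extend (𝓡 n)).symm x) (coordVec (𝓡 n) e x v) = v := fun v =>
    (congrArg (fun L : EuclideanSpace ℝ (Fin n) →L[ℝ] EuclideanSpace ℝ (Fin n) => L v) h2).symm
  rw [← h4 v, hvw, h4]

theorem coordVec_surjective (he : e ∈ IsManifold.maximalAtlas (𝓡 n) ∞ M)
    {x : EuclideanSpace ℝ (Fin n)} (hx : x ∈ (e.extend (𝓡 n)).target) :
    Function.Surjective (coordVec (𝓡 n) e x) := by
  -- The tangent space is the model space by definition, so an injective differential is an
  -- injective endomorphism of a finite-dimensional space.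
  have h : ∀ L : EuclideanSpace ℝ (Fin n) →L[ℝ] EuclideanSpace ℝ (Fin n),
      Function.Injective L → Function.Surjective L := fun L hL =>
    (LinearMap.injective_iff_surjective (f := L.toLinearMap)).mp hL
  exact h (coordVec (𝓡 n) e x) (coordVec_injective he hx)

theorem PseudoMetric.coord_apply (g : PseudoMetric (𝓡 n) M) (x : EuclideanSpace ℝ (Fin n))
    (i j : Fin n) :
    g.coord e x i j = g.form ((e.extend (𝓡 n)).symm x) (coordVec (𝓡 n) e x (stdBasis n i))
      (coordVec (𝓡 n) e x (stdBasis n j)) := rfl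

theorem PseudoMetric.isMetricOn_coord (g : PseudoMetric (𝓡 n) M)
    (he : e ∈ IsManifold.maximalAtlas (𝓡 n) ∞ M) :
    IsMetricOn (g.coord e) (e.extend (𝓡 n)).target where
  isOpen := e.isOpen_extend_target
  smooth i j x hx := (g.smooth e he (stdBasis n i) (stdBasis n j)).contDiffAt
    (e.isOpen_extend_target.mem_nhds hx)
  symm x _ i j := g.symm _ _ _
  det_ne_zero x hx hdet := by
    -- A kernel vector of the component matrix gives a tangent vector orthogonal to all coordinate
    -- vectors, hence to everything, contradicting nondegeneracy.
    obtain ⟨v, hv, hGv⟩ := Matrix.exists_mulVec_eq_zero_iff.mpr hdet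
    let y := ∑ j, v j • stdBasis n j
    have h1 : ∀ i, g.form _ (coordVec (𝓡 n) e x y) (coordVec (𝓡 n) e x (stdBasis n i)) = 0 := by
      intro i
      rw [g.symm]
      refine Eq.trans ?_ (congrFun hGv i)
      simp only [y, map_sum, map_smul, Matrix.mulVec, dotProduct, PseudoMetric.coord_apply,
        smul_eq_mul]
      exact Finset.sum_congr rfl fun j _ => mul_comm _ _
    have h2 : coordVec (𝓡 n) e x y = 0 := by
      refine g.nondegenerate _ _ fun w => ?_
      obtain ⟨w, rfl⟩ := coordVec_surjective he hx w
      rw [← (stdBasis n).sum_repr w]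
      simp only [map_sum, map_smul, h1, smul_zero, Finset.sum_const_zero]
    have h3 : y = 0 := coordVec_injective he hx (h2.trans (map_zero _).symm)
    exact hv (funext fun j => Fintype.linearIndependent_iff.mp (stdBasis n).linearIndependent v h3 j)

/-- The inverse of the product chart is the product of the identity, the inverse of `e` and the
identity, and so is its differential. -/
theorem coordVec_ambChart (he : e ∈ IsManifold.maximalAtlas (𝓡 n) ∞ M)
    {x : EuclideanSpace ℝ (Fin n)} (hx : x ∈ (e.extend (𝓡 n)).target) (t ρ : ℝ)
    (v : ℝ × EuclideanSpace ℝ (Fin n) × ℝ) :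
    coordVec (ambModel n) (ambChart e) (t, x, ρ) v = (v.1, coordVec (𝓡 n) e x v.2.1, v.2.2) := by
  have h := (mdifferentiableAt_extend_symm he hx).hasMFDerivAt
  have h2 : HasMFDerivAt 𝓘(ℝ, ℝ × EuclideanSpace ℝ (Fin n) × ℝ) (ambModel n)
      ((ambChart e).extend (ambModel n)).symm (t, x, ρ)
      ((ContinuousLinearMap.id ℝ ℝ).prodMap (ContinuousLinearMap.prodMap
        (mfderiv 𝓘(ℝ, EuclideanSpace ℝ (Fin n)) (𝓡 n) (e.extend (𝓡 n)).symm x :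
          EuclideanSpace ℝ (Fin n) →L[ℝ] EuclideanSpace ℝ (Fin n))
        (ContinuousLinearMap.id ℝ ℝ))) := by
    refine ⟨?_, ?_⟩
    · exact continuousAt_id.prodMap (h.1.prodMap continuousAt_id)
    · have h3 : HasFDerivAt (writtenInExtChartAt 𝓘(ℝ, EuclideanSpace ℝ (Fin n)) (𝓡 n) x
          (e.extend (𝓡 n)).symm) (mfderiv 𝓘(ℝ, EuclideanSpace ℝ (Fin n)) (𝓡 n)
          (e.extend (𝓡 n)).symm x : EuclideanSpace ℝ (Fin n) →L[ℝ] EuclideanSpace ℝ (Fin n)) x := by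
        have h4 := h.2
        rw [ModelWithCorners.range_eq_univ] at h4
        exact hasFDerivWithinAt_univ.mp h4
      have h5 := HasFDerivAt.prodMap (t, x, ρ) (hasFDerivAt_id (𝕜 := ℝ) t)
        (HasFDerivAt.prodMap (x, ρ) h3 (hasFDerivAt_id (𝕜 := ℝ) ρ))
      exact h5.hasFDerivWithinAt
  rw [coordVec, h2.mfderiv]
  rfl

end ManifoldMetrics

/-! ### The ambient metric in coordinates -/

section AmbientCoordinates

variable {n : ℕ}

theorem sum_ambIdx (f : AmbIdx n → ℝ) :
    ∑ A, f A = f (Sum.inl ()) + (∑ i, f (Sum.inr (Sum.inl i)) + f (Sum.inr (Sum.inr ()))) := by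
  simp [Fintype.sum_sum_type]

theorem ambBasis_inl (u : Unit) : ambBasis n (Sum.inl u) = (1, 0, 0) := by
  simp [ambBasis]
  rfl

theorem ambBasis_mid (i : Fin n) : ambBasis n (Sum.inr (Sum.inl i)) = (0, stdBasis n i, 0) := by
  simp [ambBasis]

theorem ambBasis_inr (u : Unit) : ambBasis n (Sum.inr (Sum.inr u)) = (0, 0, 1) := by
  simp [ambBasis]

/-! ### Partial derivatives of functions `φ(t, ρ) h(x)` -/

section Separable

variable {f : ℝ × EuclideanSpace ℝ (Fin n) × ℝ → ℝ} {φ : ℝ → ℝ → ℝ}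
  {h : EuclideanSpace ℝ (Fin n) → ℝ} {t ρ d : ℝ} {x : EuclideanSpace ℝ (Fin n)}

theorem differentiableAt_separable
    (hf : ∀ᶠ y in nhds (t, x, ρ), f y = φ y.1 y.2.2 * h y.2.1)
    (hφ : DifferentiableAt ℝ (fun p : ℝ × ℝ => φ p.1 p.2) (t, ρ)) (hh : DifferentiableAt ℝ h x) :
    DifferentiableAt ℝ f (t, x, ρ) := by
  have h1 : DifferentiableAt ℝ
      (fun y : ℝ × EuclideanSpace ℝ (Fin n) × ℝ => φ y.1 y.2.2) (t, x, ρ) :=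
    DifferentiableAt.comp (t, x, ρ) (g := fun p : ℝ × ℝ => φ p.1 p.2)
      (f := fun y : ℝ × EuclideanSpace ℝ (Fin n) × ℝ => (y.1, y.2.2)) hφ (by fun_prop)
  have h2 : DifferentiableAt ℝ
      (fun y : ℝ × EuclideanSpace ℝ (Fin n) × ℝ => h y.2.1) (t, x, ρ) :=
    DifferentiableAt.comp (t, x, ρ) (g := h)
      (f := fun y : ℝ × EuclideanSpace ℝ (Fin n) × ℝ => y.2.1) hh (by fun_prop)
  exact (h1.mul h2).congr_of_eventuallyEq hf

/-- Restrict to the coordinate line, where only `φ` varies, and use uniqueness of derivatives. The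
product form is required only near the point, since ambient components are known only on an open
set. -/
theorem pderiv_separable_inl
    (hf : ∀ᶠ y in nhds (t, x, ρ), f y = φ y.1 y.2.2 * h y.2.1)
    (hφ : DifferentiableAt ℝ (fun p : ℝ × ℝ => φ p.1 p.2) (t, ρ)) (hh : DifferentiableAt ℝ h x)
    (hd : HasDerivAt (fun s => φ s ρ) d t) :
    pderiv (ambBasis n) (Sum.inl ()) f (t, x, ρ) = d * h x := by
  have h1 := (differentiableAt_separable hf hφ hh).hasFDerivAt
  have hc : HasDerivAt (fun s : ℝ => (s, x, ρ)) ((1 : ℝ), (0 : EuclideanSpace ℝ (Fin n)), (0 : ℝ)) t :=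
    (hasDerivAt_id t).prodMk (hasDerivAt_const t (x, ρ))
  have h2 := h1.comp_hasDerivAt t hc
  have h3 : HasDerivAt (f ∘ fun s : ℝ => (s, x, ρ)) (d * h x) t :=
    (hd.mul_const (h x)).congr_of_eventuallyEq (hc.continuousAt.eventually hf)
  rw [pderiv, ambBasis_inl]
  exact h2.unique h3

theorem pderiv_separable_inr
    (hf : ∀ᶠ y in nhds (t, x, ρ), f y = φ y.1 y.2.2 * h y.2.1)
    (hφ : DifferentiableAt ℝ (fun p : ℝ × ℝ => φ p.1 p.2) (t, ρ)) (hh : DifferentiableAt ℝ h x)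
    (hd : HasDerivAt (fun s => φ t s) d ρ) :
    pderiv (ambBasis n) (Sum.inr (Sum.inr ())) f (t, x, ρ) = d * h x := by
  have h1 := (differentiableAt_separable hf hφ hh).hasFDerivAt
  have hc : HasDerivAt (fun s : ℝ => (t, x, s)) ((0 : ℝ), (0 : EuclideanSpace ℝ (Fin n)), (1 : ℝ)) ρ :=
    (hasDerivAt_const ρ t).prodMk ((hasDerivAt_const ρ x).prodMk (hasDerivAt_id ρ))
  have h2 := h1.comp_hasDerivAt ρ hc
  have h3 : HasDerivAt (f ∘ fun s : ℝ => (t, x, s)) (d * h x) ρ :=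
    (hd.mul_const (h x)).congr_of_eventuallyEq (hc.continuousAt.eventually hf)
  rw [pderiv, ambBasis_inr]
  exact h2.unique h3

theorem pderiv_separable_mid (i : Fin n)
    (hf : ∀ᶠ y in nhds (t, x, ρ), f y = φ y.1 y.2.2 * h y.2.1)
    (hφ : DifferentiableAt ℝ (fun p : ℝ × ℝ => φ p.1 p.2) (t, ρ)) (hh : DifferentiableAt ℝ h x) :
    pderiv (ambBasis n) (Sum.inr (Sum.inl i)) f (t, x, ρ)
      = φ t ρ * pderiv (stdBasis n) i h x := by
  have h1 := (differentiableAt_separable hf hφ hh).hasFDerivAt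
  have hc : HasFDerivAt (fun y : EuclideanSpace ℝ (Fin n) => (t, y, ρ))
      ((0 : EuclideanSpace ℝ (Fin n) →L[ℝ] ℝ).prod
        ((ContinuousLinearMap.id ℝ (EuclideanSpace ℝ (Fin n))).prod 0)) x :=
    (hasFDerivAt_const t x).prodMk ((hasFDerivAt_id x).prodMk (hasFDerivAt_const ρ x))
  have h2 := h1.comp x hc
  have h3 : HasFDerivAt (f ∘ fun y : EuclideanSpace ℝ (Fin n) => (t, y, ρ))
      (φ t ρ • fderiv ℝ h x) x :=
    (hh.hasFDerivAt.const_mul (φ t ρ)).congr_of_eventuallyEq (hc.continuousAt.eventually hf)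
  have h4 := congrArg (fun L : EuclideanSpace ℝ (Fin n) →L[ℝ] ℝ => L (stdBasis n i)) (h2.unique h3)
  rw [pderiv, ambBasis_mid]
  exact h4

end Separable

/-- The matrix of the ambient metric `2 ρ dt² + 2 t dt dρ + τ² g`, `τ = t (1 + λ ρ)`. -/
def ambMatrix (G : EuclideanSpace ℝ (Fin n) → Matrix (Fin n) (Fin n) ℝ) (lam : ℝ)
    (z : ℝ × EuclideanSpace ℝ (Fin n) × ℝ) : Matrix (AmbIdx n) (AmbIdx n) ℝ
  | Sum.inl _, Sum.inl _ => 2 * z.2.2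
  | Sum.inl _, Sum.inr (Sum.inr _) => z.1
  | Sum.inr (Sum.inr _), Sum.inl _ => z.1
  | Sum.inr (Sum.inl i), Sum.inr (Sum.inl j) => (z.1 * (1 + lam * z.2.2)) ^ 2 * G z.2.1 i j
  | _, _ => 0

/-- The matrix of the inverse ambient metric. -/
noncomputable def ambInverse (G : EuclideanSpace ℝ (Fin n) → Matrix (Fin n) (Fin n) ℝ) (lam : ℝ)
    (z : ℝ × EuclideanSpace ℝ (Fin n) × ℝ) : Matrix (AmbIdx n) (AmbIdx n) ℝ
  | Sum.inl _, Sum.inr (Sum.inr _) => z.1⁻¹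
  | Sum.inr (Sum.inr _), Sum.inl _ => z.1⁻¹
  | Sum.inr (Sum.inr _), Sum.inr (Sum.inr _) => -2 * z.2.2 / z.1 ^ 2
  | Sum.inr (Sum.inl i), Sum.inr (Sum.inl j) =>
    ((z.1 * (1 + lam * z.2.2)) ^ 2)⁻¹ * (G z.2.1)⁻¹ i j
  | _, _ => 0

/-- `Gt` is the ambient metric over the metric `G` in coordinates `(t, x, ρ)` on `V`. -/
structure IsAmbientOn (Gt : ℝ × EuclideanSpace ℝ (Fin n) × ℝ → Matrix (AmbIdx n) (AmbIdx n) ℝ)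
    (G : EuclideanSpace ℝ (Fin n) → Matrix (Fin n) (Fin n) ℝ) (lam : ℝ)
    (U : Set (EuclideanSpace ℝ (Fin n))) (V : Set (ℝ × EuclideanSpace ℝ (Fin n) × ℝ)) : Prop where
  base : IsMetricOn G U
  isOpen : IsOpen V
  pos : ∀ z ∈ V, 0 < z.1
  mem : ∀ z ∈ V, z.2.1 ∈ U
  one_add_pos : ∀ z ∈ V, 0 < 1 + lam * z.2.2
  eq_ambMatrix : ∀ z ∈ V, Gt z = ambMatrix G lam z

namespace IsAmbientOn

variable {Gt : ℝ × EuclideanSpace ℝ (Fin n) × ℝ → Matrix (AmbIdx n) (AmbIdx n) ℝ}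
  {G : EuclideanSpace ℝ (Fin n) → Matrix (Fin n) (Fin n) ℝ} {lam : ℝ}
  {U : Set (EuclideanSpace ℝ (Fin n))} {V : Set (ℝ × EuclideanSpace ℝ (Fin n) × ℝ)}
  (hA : IsAmbientOn Gt G lam U V)
include hA

theorem eventually {z : ℝ × EuclideanSpace ℝ (Fin n) × ℝ} (hz : z ∈ V) : ∀ᶠ y in nhds z, y ∈ V :=
  hA.isOpen.mem_nhds hz

theorem mul_ambInverse {z : ℝ × EuclideanSpace ℝ (Fin n) × ℝ} (hz : z ∈ V) :
    Gt z * ambInverse G lam z = 1 := by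
  have ht := (hA.pos z hz).ne'
  have hr := (hA.one_add_pos z hz).ne'
  have hG := hA.base.mul_inv (hA.mem z hz)
  rw [hA.eq_ambMatrix z hz]
  ext (_ | i | _) (_ | j | _) <;> rw [Matrix.mul_apply, sum_ambIdx] <;>
    simp [ambMatrix, ambInverse, ht, Matrix.one_apply]
  · field_simp
    ring
  · have h := congrFun (congrFun hG i) j
    rw [Matrix.mul_apply, Matrix.one_apply] at h
    rw [← h]
    refine Finset.sum_congr rfl fun k _ => ?_
    field_simp

theorem inv_eq {z : ℝ × EuclideanSpace ℝ (Fin n) × ℝ} (hz : z ∈ V) :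
    (Gt z)⁻¹ = ambInverse G lam z :=
  Matrix.inv_eq_right_inv (hA.mul_ambInverse hz)

theorem isMetricOn : IsMetricOn Gt V where
  isOpen := hA.isOpen
  smooth A B z hz := by
    have h : (fun y => Gt y A B) =ᶠ[nhds z] fun y => ambMatrix G lam y A B :=
      (hA.eventually hz).mono fun y hy => congrFun (congrFun (hA.eq_ambMatrix y hy) A) B
    refine ContDiffAt.congr_of_eventuallyEq ?_ h
    have hG : ∀ i j, ContDiffAt ℝ ∞
        (fun y : ℝ × EuclideanSpace ℝ (Fin n) × ℝ => G y.2.1 i j) z := fun i j =>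
      ContDiffAt.comp z (g := fun x => G x i j) (hA.base.smooth i j _ (hA.mem z hz))
        contDiffAt_snd.fst
    rcases A with _ | i | _ <;> rcases B with _ | j | _ <;> simp only [ambMatrix] <;>
      first | fun_prop | exact ContDiffAt.mul (by fun_prop) (hG i j)
  symm z hz A B := by
    rw [hA.eq_ambMatrix z hz]
    rcases A with _ | i | _ <;> rcases B with _ | j | _ <;> simp only [ambMatrix]
    rw [hA.base.symm _ (hA.mem z hz)]
  det_ne_zero z hz h := by
    have := congrArg Matrix.det (hA.mul_ambInverse hz)
    simp [h] at this

end IsAmbientOn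

end AmbientCoordinates

/-! ### The Levi-Civita connection of the ambient metric -/

section AmbientConnection

variable {n : ℕ}

theorem differentiableAt_tau (lam : ℝ) (z : ℝ × ℝ) :
    DifferentiableAt ℝ (fun p : ℝ × ℝ => p.1 * (1 + lam * p.2)) z := by
  fun_prop

theorem hasDerivAt_tau_left (lam t ρ : ℝ) :
    HasDerivAt (fun s => s * (1 + lam * ρ)) (1 + lam * ρ) t := by
  simpa using (hasDerivAt_id t).mul_const (1 + lam * ρ)

theorem hasDerivAt_tau_right (lam t ρ : ℝ) :
    HasDerivAt (fun s => t * (1 + lam * s)) (t * lam) ρ := by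
  simpa using (((hasDerivAt_id ρ).const_mul lam).const_add 1).const_mul t

namespace IsAmbientOn

variable {Gt : ℝ × EuclideanSpace ℝ (Fin n) × ℝ → Matrix (AmbIdx n) (AmbIdx n) ℝ}
  {G : EuclideanSpace ℝ (Fin n) → Matrix (Fin n) (Fin n) ℝ} {lam : ℝ}
  {U : Set (EuclideanSpace ℝ (Fin n))} {V : Set (ℝ × EuclideanSpace ℝ (Fin n) × ℝ)}
  {t ρ : ℝ} {x : EuclideanSpace ℝ (Fin n)}
  (hA : IsAmbientOn Gt G lam U V) (hz : (t, x, ρ) ∈ V)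
include hA hz

/-! #### Partial derivatives of the components of the ambient metric -/

theorem eventually_apply (A B : AmbIdx n) :
    ∀ᶠ y in nhds (t, x, ρ), Gt y A B = ambMatrix G lam y A B :=
  (hA.eventually hz).mono fun y hy => congrFun (congrFun (hA.eq_ambMatrix y hy) A) B

theorem differentiableAt_base (i j : Fin n) : DifferentiableAt ℝ (fun y => G y i j) x :=
  differentiableAt_of_contDiffAt (hA.base.smooth i j x (hA.mem _ hz))

theorem pderiv_inl (A B : AmbIdx n) :
    pderiv (ambBasis n) (Sum.inl ()) (fun y => Gt y A B) (t, x, ρ) =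
      match A, B with
      | Sum.inl _, Sum.inr (Sum.inr _) => 1
      | Sum.inr (Sum.inr _), Sum.inl _ => 1
      | Sum.inr (Sum.inl i), Sum.inr (Sum.inl j) =>
        2 * (t * (1 + lam * ρ)) * (1 + lam * ρ) * G x i j
      | _, _ => 0 := by
  rw [pderiv_congr (hA.eventually_apply hz A B)]
  rcases A with _ | i | _ <;> rcases B with _ | j | _ <;> simp only [ambMatrix, pderiv_const]
  · refine (pderiv_separable_inl (φ := fun _ s => 2 * s) (h := fun _ => 1) (d := 0)
      (Filter.Eventually.of_forall fun y => by simp) (by fun_prop) (by fun_prop)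
      (hasDerivAt_const _ _)).trans (by simp)
  · refine (pderiv_separable_inl (φ := fun s _ => s) (h := fun _ => 1) (d := 1)
      (Filter.Eventually.of_forall fun y => by simp) (by fun_prop) (by fun_prop)
      (hasDerivAt_id _)).trans (by simp)
  · refine pderiv_separable_inl (φ := fun s r => (s * (1 + lam * r)) ^ 2) (h := fun y => G y i j)
      (Filter.Eventually.of_forall fun y => rfl) (by fun_prop) (hA.differentiableAt_base hz i j) ?_
    simpa using (hasDerivAt_tau_left lam t ρ).fun_pow 2
  · refine (pderiv_separable_inl (φ := fun s _ => s) (h := fun _ => 1) (d := 1)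
      (Filter.Eventually.of_forall fun y => by simp) (by fun_prop) (by fun_prop)
      (hasDerivAt_id _)).trans (by simp)

theorem pderiv_inr (A B : AmbIdx n) :
    pderiv (ambBasis n) (Sum.inr (Sum.inr ())) (fun y => Gt y A B) (t, x, ρ) =
      match A, B with
      | Sum.inl _, Sum.inl _ => 2
      | Sum.inr (Sum.inl i), Sum.inr (Sum.inl j) =>
        2 * (t * (1 + lam * ρ)) * (t * lam) * G x i j
      | _, _ => 0 := by
  rw [pderiv_congr (hA.eventually_apply hz A B)]
  rcases A with _ | i | _ <;> rcases B with _ | j | _ <;> simp only [ambMatrix, pderiv_const]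
  · refine (pderiv_separable_inr (φ := fun _ s => 2 * s) (h := fun _ => 1) (d := 2)
      (Filter.Eventually.of_forall fun y => by simp) (by fun_prop) (by fun_prop)
      (by simpa using (hasDerivAt_id ρ).const_mul 2)).trans (by simp)
  · refine (pderiv_separable_inr (φ := fun s _ => s) (h := fun _ => 1) (d := 0)
      (Filter.Eventually.of_forall fun y => by simp) (by fun_prop) (by fun_prop)
      (hasDerivAt_const _ _)).trans (by simp)
  · refine pderiv_separable_inr (φ := fun s r => (s * (1 + lam * r)) ^ 2) (h := fun y => G y i j)
      (Filter.Eventually.of_forall fun y => rfl) (by fun_prop) (hA.differentiableAt_base hz i j) ?_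
    simpa using (hasDerivAt_tau_right lam t ρ).fun_pow 2
  · refine (pderiv_separable_inr (φ := fun s _ => s) (h := fun _ => 1) (d := 0)
      (Filter.Eventually.of_forall fun y => by simp) (by fun_prop) (by fun_prop)
      (hasDerivAt_const _ _)).trans (by simp)

theorem pderiv_mid (k : Fin n) (A B : AmbIdx n) :
    pderiv (ambBasis n) (Sum.inr (Sum.inl k)) (fun y => Gt y A B) (t, x, ρ) =
      match A, B with
      | Sum.inr (Sum.inl i), Sum.inr (Sum.inl j) =>
        (t * (1 + lam * ρ)) ^ 2 * pderiv (stdBasis n) k (fun y => G y i j) x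
      | _, _ => 0 := by
  rw [pderiv_congr (hA.eventually_apply hz A B)]
  rcases A with _ | i | _ <;> rcases B with _ | j | _ <;> simp only [ambMatrix, pderiv_const]
  · refine (pderiv_separable_mid k (φ := fun _ s => 2 * s) (h := fun _ => 1)
      (Filter.Eventually.of_forall fun y => by simp) (by fun_prop)
      (by fun_prop)).trans (by simp [pderiv_const])
  · refine (pderiv_separable_mid k (φ := fun s _ => s) (h := fun _ => 1)
      (Filter.Eventually.of_forall fun y => by simp) (by fun_prop)
      (by fun_prop)).trans (by simp [pderiv_const])
  · exact pderiv_separable_mid k (φ := fun s r => (s * (1 + lam * r)) ^ 2) (h := fun y => G y i j)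
      (Filter.Eventually.of_forall fun y => rfl) (by fun_prop) (hA.differentiableAt_base hz i j)
  · refine (pderiv_separable_mid k (φ := fun s _ => s) (h := fun _ => 1)
      (Filter.Eventually.of_forall fun y => by simp) (by fun_prop)
      (by fun_prop)).trans (by simp [pderiv_const])

/-! #### Christoffel symbols of the ambient metric -/

/-- In the base directions `τ²` is constant, so it cancels as for a constant rescaling. -/
theorem christoffel_mid_mid_mid (i j k : Fin n) :
    christoffel (ambBasis n) Gt (Sum.inr (Sum.inl i)) (Sum.inr (Sum.inl j)) (Sum.inr (Sum.inl k))
      (t, x, ρ) = christoffel (stdBasis n) G i j k x := by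
  have ht := (hA.pos _ hz).ne'
  have hr := (hA.one_add_pos _ hz).ne'
  simp only at ht hr
  simp only [christoffel, sum_ambIdx, hA.inv_eq hz, hA.pderiv_mid hz, ambInverse, zero_mul, zero_add,
    add_zero]
  congr 1
  refine Finset.sum_congr rfl fun m _ => ?_
  field_simp

theorem christoffel_mid_mid_inl (i j : Fin n) :
    christoffel (ambBasis n) Gt (Sum.inr (Sum.inl i)) (Sum.inr (Sum.inl j)) (Sum.inl ())
      (t, x, ρ) = -(t * (1 + lam * ρ) * lam * G x i j) := by
  have ht := (hA.pos _ hz).ne'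
  simp only at ht
  simp only [christoffel, sum_ambIdx, hA.inv_eq hz, hA.pderiv_mid hz, hA.pderiv_inr hz,
    hA.pderiv_inl hz, ambInverse, zero_mul, zero_add, add_zero, Finset.sum_const_zero]
  field_simp
  ring

/-- Raising the index combines the `t`- and `ρ`-derivatives of `τ²`, with the coefficients `t⁻¹` and
`-2ρ/t²` of the inverse metric. -/
theorem christoffel_mid_mid_inr (i j : Fin n) :
    christoffel (ambBasis n) Gt (Sum.inr (Sum.inl i)) (Sum.inr (Sum.inl j)) (Sum.inr (Sum.inr ()))
      (t, x, ρ) = -((1 + lam * ρ) * (1 - lam * ρ) * G x i j) := by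
  have ht := (hA.pos _ hz).ne'
  simp only at ht
  simp only [christoffel, sum_ambIdx, hA.inv_eq hz, hA.pderiv_mid hz, hA.pderiv_inr hz,
    hA.pderiv_inl hz, ambInverse, zero_mul, zero_add, add_zero, Finset.sum_const_zero]
  field_simp
  ring

/-- The coefficient is the logarithmic derivative of `τ` along `t`; in `christoffel_mid_inr_mid` it
is the one along `ρ`. -/
theorem christoffel_mid_inl_mid (i k : Fin n) :
    christoffel (ambBasis n) Gt (Sum.inr (Sum.inl i)) (Sum.inl ()) (Sum.inr (Sum.inl k))
      (t, x, ρ) = if i = k then t⁻¹ else 0 := by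
  have ht := (hA.pos _ hz).ne'
  have hr := (hA.one_add_pos _ hz).ne'
  simp only at ht hr
  have hG := congrFun (congrFun (hA.base.inv_mul (hA.mem _ hz)) k) i
  simp only [Matrix.mul_apply, Matrix.one_apply] at hG
  simp only [christoffel, sum_ambIdx, hA.inv_eq hz, hA.pderiv_mid hz, hA.pderiv_inl hz, ambInverse,
    zero_mul, zero_add, add_zero, sub_zero]
  calc _ = t⁻¹ * ∑ m, (G x)⁻¹ k m * G x m i := by
        rw [Finset.mul_sum, Finset.mul_sum]
        refine Finset.sum_congr rfl fun m _ => ?_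
        rw [hA.base.symm x (hA.mem _ hz) i m]
        field_simp
    _ = _ := by rw [hG]; simp [eq_comm]

theorem christoffel_mid_inr_mid (i k : Fin n) :
    christoffel (ambBasis n) Gt (Sum.inr (Sum.inl i)) (Sum.inr (Sum.inr ())) (Sum.inr (Sum.inl k))
      (t, x, ρ) = if i = k then lam * (1 + lam * ρ)⁻¹ else 0 := by
  have ht := (hA.pos _ hz).ne'
  have hr := (hA.one_add_pos _ hz).ne'
  simp only at ht hr
  have hG := congrFun (congrFun (hA.base.inv_mul (hA.mem _ hz)) k) i
  simp only [Matrix.mul_apply, Matrix.one_apply] at hG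
  simp only [christoffel, sum_ambIdx, hA.inv_eq hz, hA.pderiv_mid hz, hA.pderiv_inr hz, ambInverse,
    zero_mul, zero_add, add_zero, sub_zero]
  calc _ = lam * (1 + lam * ρ)⁻¹ * ∑ m, (G x)⁻¹ k m * G x m i := by
        rw [Finset.mul_sum, Finset.mul_sum]
        refine Finset.sum_congr rfl fun m _ => ?_
        rw [hA.base.symm x (hA.mem _ hz) i m]
        field_simp
    _ = _ := by rw [hG]; simp [eq_comm]

theorem christoffel_inl_inr (C : AmbIdx n) :
    christoffel (ambBasis n) Gt (Sum.inl ()) (Sum.inr (Sum.inr ())) C (t, x, ρ)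
      = if C = Sum.inr (Sum.inr ()) then t⁻¹ else 0 := by
  simp only [christoffel, sum_ambIdx, hA.inv_eq hz, hA.pderiv_mid hz, hA.pderiv_inl hz,
    hA.pderiv_inr hz]
  rcases C with _ | k | _ <;> simp [ambInverse]
  ring

theorem christoffel_inr_inl (C : AmbIdx n) :
    christoffel (ambBasis n) Gt (Sum.inr (Sum.inr ())) (Sum.inl ()) C (t, x, ρ)
      = if C = Sum.inr (Sum.inr ()) then t⁻¹ else 0 := by
  simp only [christoffel, sum_ambIdx, hA.inv_eq hz, hA.pderiv_mid hz, hA.pderiv_inl hz,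
    hA.pderiv_inr hz]
  rcases C with _ | k | _ <;> simp [ambInverse]
  ring

theorem christoffel_inr_inr (C : AmbIdx n) :
    christoffel (ambBasis n) Gt (Sum.inr (Sum.inr ())) (Sum.inr (Sum.inr ())) C (t, x, ρ) = 0 := by
  simp only [christoffel, sum_ambIdx, hA.inv_eq hz, hA.pderiv_mid hz, hA.pderiv_inl hz,
    hA.pderiv_inr hz]
  rcases C with _ | k | _ <;> simp [ambInverse]

end IsAmbientOn

end AmbientConnection

/-! ### Covariant derivatives in rank at most two -/

section LowRank

variable {E ι : Type*} [NormedAddCommGroup E] [NormedSpace ℝ E] [Fintype ι] [DecidableEq ι]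
  (b : Module.Basis ι ℝ E) (G : E → Matrix ι ι ℝ)

theorem covDeriv_rank_zero (f : E → (Fin 0 → ι) → ℝ) (x : E) (a : Fin 1 → ι) :
    covDeriv b G f x a = pderiv b (a 0) (fun y => f y ![]) x := by
  simp only [covDeriv, Finset.univ_eq_empty, Finset.sum_empty, sub_zero]
  congr 1
  exact funext fun y => congrArg (f y) (Subsingleton.elim _ _)

theorem covDeriv_rank_one (V : E → (Fin 1 → ι) → ℝ) (x : E) (i j : ι) :
    covDeriv b G V x ![i, j] = pderiv b i (fun y => V y ![j]) x
      - ∑ l, christoffel b G i j l x * V x ![l] := by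
  simp only [covDeriv, Finset.univ_unique, Finset.sum_singleton]
  refine congrArg₂ (· - ·) rfl (Finset.sum_congr rfl fun l _ => ?_)
  refine congrArg₂ (· * ·) rfl (congrArg (V x) ?_)
  ext s
  fin_cases s
  rfl

theorem covDeriv_rank_two (T : E → (Fin 2 → ι) → ℝ) (x : E) (q i j : ι) :
    covDeriv b G T x ![q, i, j] = pderiv b q (fun y => T y ![i, j]) x
      - (∑ l, christoffel b G q i l x * T x ![l, j]
        + ∑ l, christoffel b G q j l x * T x ![i, l]) := by
  simp only [covDeriv, Fin.sum_univ_two]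
  refine congrArg₂ (· - ·) rfl (congrArg₂ (· + ·) ?_ ?_) <;>
    refine Finset.sum_congr rfl fun l _ => congrArg₂ (· * ·) rfl (congrArg (T x) ?_) <;>
    ext s <;> fin_cases s <;> rfl

end LowRank

/-! ### Ambient divergence of 1-forms built from `π` and `τ` -/

section AmbientDivergence

variable {n : ℕ}

namespace IsAmbientOn

variable {Gt : ℝ × EuclideanSpace ℝ (Fin n) × ℝ → Matrix (AmbIdx n) (AmbIdx n) ℝ}
  {G : EuclideanSpace ℝ (Fin n) → Matrix (Fin n) (Fin n) ℝ} {lam : ℝ}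
  {U : Set (EuclideanSpace ℝ (Fin n))} {V : Set (ℝ × EuclideanSpace ℝ (Fin n) × ℝ)}
  {t ρ : ℝ} {x : EuclideanSpace ℝ (Fin n)} (hA : IsAmbientOn Gt G lam U V)
include hA

theorem tau_pos (hz : (t, x, ρ) ∈ V) : 0 < t * (1 + lam * ρ) :=
  mul_pos (hA.pos _ hz) (hA.one_add_pos _ hz)

theorem differentiableAt_tau_rpow (hz : (t, x, ρ) ∈ V) (r : ℝ) :
    DifferentiableAt ℝ (fun p : ℝ × ℝ => (p.1 * (1 + lam * p.2)) ^ r) (t, ρ) :=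
  (differentiableAt_tau lam (t, ρ)).rpow_const (Or.inl (hA.tau_pos hz).ne')

theorem hasDerivAt_tau_rpow_left (hz : (t, x, ρ) ∈ V) (r : ℝ) :
    HasDerivAt (fun s => (s * (1 + lam * ρ)) ^ r)
      ((1 + lam * ρ) * r * (t * (1 + lam * ρ)) ^ (r - 1)) t :=
  (hasDerivAt_tau_left lam t ρ).rpow_const (Or.inl (hA.tau_pos hz).ne')

theorem hasDerivAt_tau_rpow_right (hz : (t, x, ρ) ∈ V) (r : ℝ) :
    HasDerivAt (fun s => (t * (1 + lam * s)) ^ r)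
      (t * lam * r * (t * (1 + lam * ρ)) ^ (r - 1)) ρ :=
  (hasDerivAt_tau_right lam t ρ).rpow_const (Or.inl (hA.tau_pos hz).ne')

theorem sum_inv_mul_metric (hz : (t, x, ρ) ∈ V) :
    ∑ i, ∑ p, (G x)⁻¹ i p * G x i p = n := by
  have h := congrArg Matrix.trace (hA.base.inv_mul (hA.mem _ hz))
  rw [Matrix.trace_one, Fintype.card_fin] at h
  rw [← h, Matrix.trace]
  refine Finset.sum_congr rfl fun i _ => ?_
  rw [Matrix.diag_apply, Matrix.mul_apply]
  exact Finset.sum_congr rfl fun p _ => by rw [hA.base.symm _ (hA.mem _ hz) i p]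

/-- The divergence of `τ^r π^* α + c τ^{r-1} f dτ`. -/
theorem divergence_eq (hz : (t, x, ρ) ∈ V) {r c : ℝ}
    {W : ℝ × EuclideanSpace ℝ (Fin n) × ℝ → (Fin 1 → AmbIdx n) → ℝ}
    {α : EuclideanSpace ℝ (Fin n) → (Fin 1 → Fin n) → ℝ} {f : EuclideanSpace ℝ (Fin n) → ℝ}
    (hα : IsSmoothTensorOn α U) (hf : ∀ y ∈ U, DifferentiableAt ℝ f y)
    (hmid : ∀ z ∈ V, ∀ i, W z ![Sum.inr (Sum.inl i)]
      = (z.1 * (1 + lam * z.2.2)) ^ r * α z.2.1 ![i])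
    (hinl : ∀ z ∈ V, W z ![Sum.inl ()]
      = (1 + lam * z.2.2) * (z.1 * (1 + lam * z.2.2)) ^ (r - 1) * (c * f z.2.1))
    (hinr : ∀ z ∈ V, W z ![Sum.inr (Sum.inr ())]
      = z.1 * lam * (z.1 * (1 + lam * z.2.2)) ^ (r - 1) * (c * f z.2.1)) :
    divergence (ambBasis n) Gt W (t, x, ρ)
      = (t * (1 + lam * ρ)) ^ (r - 2)
        * (divergence (stdBasis n) G α x + 2 * lam * c * (r - 1 + n) * f x) := by
  have hx := hA.mem _ hz
  have ht : t ≠ 0 := (hA.pos _ hz).ne'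
  have hr : 1 + lam * ρ ≠ 0 := (hA.one_add_pos _ hz).ne'
  have hτ := hA.tau_pos hz
  have hcf : DifferentiableAt ℝ (fun y => c * f y) x := (hf x hx).const_mul c
  have hpow1 : (t * (1 + lam * ρ)) ^ (r - 1) = (t * (1 + lam * ρ)) ^ (r - 2) * (t * (1 + lam * ρ)) := by
    rw [← Real.rpow_add_one hτ.ne']
    ring_nf
  have hpow0 : (t * (1 + lam * ρ)) ^ r
      = (t * (1 + lam * ρ)) ^ (r - 2) * (t * (1 + lam * ρ)) ^ 2 := by
    rw [← Real.rpow_natCast, ← Real.rpow_add hτ]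
    norm_num
  have hsub : r - 1 - 1 = r - 2 := by ring
  -- The two normal Christoffel terms carry the factors `1 + λρ` and `1 - λρ`, which add up to 2.
  -- This is the identity `∇²τ = 2λτ π^*g` in the base directions.
  have hmm : ∀ p i, covDeriv (ambBasis n) Gt W (t, x, ρ)
      ![Sum.inr (Sum.inl p), Sum.inr (Sum.inl i)]
      = (t * (1 + lam * ρ)) ^ r
        * (covDeriv (stdBasis n) G α x ![p, i] + 2 * lam * c * f x * G x p i) := by
    intro p i
    rw [covDeriv_rank_one, covDeriv_rank_one, sum_ambIdx,
      pderiv_separable_mid p (φ := fun s u => (s * (1 + lam * u)) ^ r) (h := fun y => α y ![i])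
        ((hA.eventually hz).mono fun z hz => hmid z hz i)
        (hA.differentiableAt_tau_rpow hz r) (differentiableAt_of_contDiffAt (hα _ x hx)),
      hinl _ hz, hinr _ hz, hA.christoffel_mid_mid_inl hz, hA.christoffel_mid_mid_inr hz]
    have hs : ∑ l, christoffel (ambBasis n) Gt (Sum.inr (Sum.inl p)) (Sum.inr (Sum.inl i))
        (Sum.inr (Sum.inl l)) (t, x, ρ) * W (t, x, ρ) ![Sum.inr (Sum.inl l)]
        = (t * (1 + lam * ρ)) ^ r * ∑ l, christoffel (stdBasis n) G p i l x * α x ![l] := by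
      rw [Finset.mul_sum]
      refine Finset.sum_congr rfl fun l _ => ?_
      rw [hA.christoffel_mid_mid_mid hz, hmid _ hz]
      ring
    rw [hs, hpow1, hpow0]
    ring
  have h01 : covDeriv (ambBasis n) Gt W (t, x, ρ) ![Sum.inl (), Sum.inr (Sum.inr ())]
      = (1 + lam * ρ) * (r - 1) * t * lam * (t * (1 + lam * ρ)) ^ (r - 2) * (c * f x) := by
    have hd := ((hasDerivAt_id t).mul_const lam).fun_mul (hA.hasDerivAt_tau_rpow_left hz (r - 1))
    rw [covDeriv_rank_one, sum_ambIdx,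
      pderiv_separable_inl (φ := fun s u => s * lam * (s * (1 + lam * u)) ^ (r - 1))
        ((hA.eventually hz).mono fun z hz => hinr z hz)
        (DifferentiableAt.fun_mul (by fun_prop) (hA.differentiableAt_tau_rpow hz (r - 1))) hcf hd]
    simp only [hA.christoffel_inl_inr hz, hinr _ hz, hpow1, hsub, id_eq]
    simp
    field_simp
    ring
  have h10 : covDeriv (ambBasis n) Gt W (t, x, ρ) ![Sum.inr (Sum.inr ()), Sum.inl ()]
      = (1 + lam * ρ) * (r - 1) * t * lam * (t * (1 + lam * ρ)) ^ (r - 2) * (c * f x) := by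
    have hd := (((hasDerivAt_id ρ).const_mul lam).const_add 1).fun_mul
      (hA.hasDerivAt_tau_rpow_right hz (r - 1))
    rw [covDeriv_rank_one, sum_ambIdx,
      pderiv_separable_inr (φ := fun s u => (1 + lam * u) * (s * (1 + lam * u)) ^ (r - 1))
        ((hA.eventually hz).mono fun z hz => hinl z hz)
        (DifferentiableAt.fun_mul (by fun_prop) (hA.differentiableAt_tau_rpow hz (r - 1))) hcf hd]
    simp only [hA.christoffel_inr_inl hz, hinr _ hz, hpow1, hsub, id_eq]
    simp
    field_simp
    ring
  have h11 : covDeriv (ambBasis n) Gt W (t, x, ρ) ![Sum.inr (Sum.inr ()), Sum.inr (Sum.inr ())]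
      = (r - 1) * (t * lam) ^ 2 * (t * (1 + lam * ρ)) ^ (r - 2) * (c * f x) := by
    have hd := (hA.hasDerivAt_tau_rpow_right hz (r - 1)).const_mul (t * lam)
    rw [covDeriv_rank_one,
      pderiv_separable_inr (φ := fun s u => s * lam * (s * (1 + lam * u)) ^ (r - 1))
        ((hA.eventually hz).mono fun z hz => hinr z hz)
        (DifferentiableAt.fun_mul (by fun_prop) (hA.differentiableAt_tau_rpow hz (r - 1))) hcf hd]
    simp only [hA.christoffel_inr_inr hz, hsub, zero_mul, Finset.sum_const_zero]
    ring
  -- The inverse metric has no `tt` entry, so that component of the derivative is not needed. The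
  -- normal components combine to `|dτ|² = 2λ` times `(r - 1) c τ^(r-2) f`; the base components
  -- contribute the multiple `n` through the trace of `g`.
  rw [divergence]
  simp only [sum_ambIdx, hA.inv_eq hz, ambInverse, hmm, h01, h10, h11, zero_mul, zero_add, add_zero,
    Finset.sum_const_zero]
  have hsum : ∑ i, ∑ p, ((t * (1 + lam * ρ)) ^ 2)⁻¹ * (G x)⁻¹ i p * ((t * (1 + lam * ρ)) ^ r
        * (covDeriv (stdBasis n) G α x ![i, p] + 2 * lam * c * f x * G x i p))
      = (t * (1 + lam * ρ)) ^ (r - 2)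
        * (divergence (stdBasis n) G α x + 2 * lam * c * f x * n) := by
    rw [← hA.sum_inv_mul_metric hz, divergence, Finset.mul_sum, ← Finset.sum_add_distrib,
      Finset.mul_sum]
    refine Finset.sum_congr rfl fun i _ => ?_
    rw [Finset.mul_sum, ← Finset.sum_add_distrib, Finset.mul_sum]
    refine Finset.sum_congr rfl fun p _ => ?_
    rw [hpow0]
    field_simp
  rw [hsum]
  field_simp
  ring

end IsAmbientOn

end AmbientDivergence

/-! ### Double divergence and Laplacian of the trace for `τ^w π^*T` -/

section PulledBackTensors

variable {n : ℕ}

theorem pullbackProj_rank_zero (S : (Fin 0 → Fin n) → ℝ) (A : Fin 0 → AmbIdx n) (a : Fin 0 → Fin n) :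
    pullbackProj S A = S a := by
  simp only [pullbackProj, Finset.univ_eq_empty, Finset.prod_empty, one_mul, Fintype.sum_unique]
  exact congrArg S (Subsingleton.elim _ _)

theorem pullbackProj_eq_zero {k : ℕ} (S : (Fin k → Fin n) → ℝ) (A : Fin k → AmbIdx n) (s : Fin k)
    (h : ∀ i, A s ≠ Sum.inr (Sum.inl i)) : pullbackProj S A = 0 := by
  refine Finset.sum_eq_zero fun a _ => ?_
  rw [Finset.prod_eq_zero (Finset.mem_univ s) (if_neg (h _)), zero_mul]

theorem pullbackProj_mid {k : ℕ} (S : (Fin k → Fin n) → ℝ) (a : Fin k → Fin n) :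
    pullbackProj S (fun s => Sum.inr (Sum.inl (a s))) = S a := by
  rw [pullbackProj, Finset.sum_eq_single a]
  · simp
  · intro c _ hc
    obtain ⟨s, hs⟩ := Function.ne_iff.mp hc
    have h : Sum.inr (Sum.inl (a s)) ≠ (Sum.inr (Sum.inl (c s)) : AmbIdx n) := fun h =>
      hs (Sum.inl_injective (Sum.inr_injective h)).symm
    rw [Finset.prod_eq_zero (Finset.mem_univ s) (if_neg h), zero_mul]
  · exact fun h => absurd (Finset.mem_univ a) h

theorem pullbackProj_mid_mid (S : (Fin 2 → Fin n) → ℝ) (i j : Fin n) :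
    pullbackProj S ![Sum.inr (Sum.inl i), Sum.inr (Sum.inl j)] = S ![i, j] := by
  rw [← pullbackProj_mid S ![i, j]]
  congr 1
  ext s
  fin_cases s <;> rfl

namespace IsAmbientOn

variable {Gt : ℝ × EuclideanSpace ℝ (Fin n) × ℝ → Matrix (AmbIdx n) (AmbIdx n) ℝ}
  {G : EuclideanSpace ℝ (Fin n) → Matrix (Fin n) (Fin n) ℝ} {lam w : ℝ}
  {U : Set (EuclideanSpace ℝ (Fin n))} {V : Set (ℝ × EuclideanSpace ℝ (Fin n) × ℝ)}
  {Tt : ℝ × EuclideanSpace ℝ (Fin n) × ℝ → (Fin 2 → AmbIdx n) → ℝ}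
  {T : EuclideanSpace ℝ (Fin n) → (Fin 2 → Fin n) → ℝ}
  (hA : IsAmbientOn Gt G lam U V)
  (hTt : ∀ z ∈ V, ∀ A, Tt z A = (z.1 * (1 + lam * z.2.2)) ^ w * pullbackProj (T z.2.1) A)
include hA in
theorem tau_rpow_sub_two {t ρ : ℝ} {x : EuclideanSpace ℝ (Fin n)} (hz : (t, x, ρ) ∈ V) :
    ((t * (1 + lam * ρ)) ^ 2)⁻¹ * (t * (1 + lam * ρ)) ^ w = (t * (1 + lam * ρ)) ^ (w - 2) := by
  rw [Real.rpow_sub (hA.tau_pos hz), Real.rpow_two, div_eq_inv_mul]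

include hA in
theorem tau_rpow_sub_one {t ρ : ℝ} {x : EuclideanSpace ℝ (Fin n)} (hz : (t, x, ρ) ∈ V) (r : ℝ) :
    (t * (1 + lam * ρ)) ^ r = (t * (1 + lam * ρ)) ^ (r - 1) * (t * (1 + lam * ρ)) := by
  rw [← Real.rpow_add_one (hA.tau_pos hz).ne', sub_add_cancel]

include hA in
theorem isSmooth_divergence₂ (hT : IsSmoothTensorOn T U) :
    IsSmoothTensorOn (divergence₂ (stdBasis n) G T) U := fun _ x hx =>
  ContDiffAt.sum fun _ _ => ContDiffAt.sum fun _ _ =>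
    (hA.base.contDiffAt_inv hx _ _).mul (hA.base.isSmooth_covDeriv _ hT _ x hx)

include hTt

theorem tensor_eq_zero_left {z : ℝ × EuclideanSpace ℝ (Fin n) × ℝ} (hz : z ∈ V) {A : AmbIdx n}
    (hn : ∀ i, A ≠ Sum.inr (Sum.inl i)) (B : AmbIdx n) : Tt z ![A, B] = 0 := by
  rw [hTt z hz, pullbackProj_eq_zero _ _ 0 hn, mul_zero]

theorem tensor_eq_zero_right {z : ℝ × EuclideanSpace ℝ (Fin n) × ℝ} (hz : z ∈ V) {A : AmbIdx n}
    (hn : ∀ i, A ≠ Sum.inr (Sum.inl i)) (B : AmbIdx n) : Tt z ![B, A] = 0 := by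
  rw [hTt z hz, pullbackProj_eq_zero _ _ 1 hn, mul_zero]

theorem tensor_mid_mid {z : ℝ × EuclideanSpace ℝ (Fin n) × ℝ} (hz : z ∈ V) (i j : Fin n) :
    Tt z ![Sum.inr (Sum.inl i), Sum.inr (Sum.inl j)]
      = (z.1 * (1 + lam * z.2.2)) ^ w * T z.2.1 ![i, j] := by
  rw [hTt z hz, pullbackProj_mid_mid]

include hA in
theorem trace₂_eq {z : ℝ × EuclideanSpace ℝ (Fin n) × ℝ} (hz : z ∈ V) (a : Fin 0 → AmbIdx n) :
    trace₂ Gt Tt z a = (z.1 * (1 + lam * z.2.2)) ^ (w - 2) * trace₂ G T z.2.1 ![] := by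
  simp only [trace₂, sum_ambIdx, hA.inv_eq hz, ambInverse, zero_mul, zero_add, add_zero,
    Finset.sum_const_zero]
  rw [tensor_eq_zero_left hTt hz (by simp), tensor_eq_zero_left hTt hz (by simp),
    tensor_eq_zero_left hTt hz (by simp), ← hA.tau_rpow_sub_two hz]
  simp only [tensor_mid_mid hTt hz, mul_zero, zero_add, add_zero, Finset.mul_sum]
  exact Finset.sum_congr rfl fun i _ => Finset.sum_congr rfl fun j _ => by ring

include hA in
-- The contractions through the normal directions `t` and `ρ` drop out: a pulled-back tensor
-- vanishes on normal vectors, and the Christoffel symbols with two normal lower indices that occur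
-- here have no base component.
theorem divergence₂_eq_sum {t ρ : ℝ} {x : EuclideanSpace ℝ (Fin n)} (hz : (t, x, ρ) ∈ V)
    (A : AmbIdx n) :
    divergence₂ (ambBasis n) Gt Tt (t, x, ρ) ![A]
      = ∑ j, ∑ q, ((t * (1 + lam * ρ)) ^ 2)⁻¹ * (G x)⁻¹ j q
        * covDeriv (ambBasis n) Gt Tt (t, x, ρ) ![Sum.inr (Sum.inl q), A, Sum.inr (Sum.inl j)] := by
  have h0 : ∀ C B, (∀ i, B ≠ Sum.inr (Sum.inl i)) →
      (∀ k, christoffel (ambBasis n) Gt C B (Sum.inr (Sum.inl k)) (t, x, ρ) = 0) →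
      covDeriv (ambBasis n) Gt Tt (t, x, ρ) ![C, A, B] = 0 := by
    intro C B hB hΓ
    rw [covDeriv_rank_two, pderiv_congr ((hA.eventually hz).mono fun z hz =>
      tensor_eq_zero_right hTt hz hB A), pderiv_const]
    simp only [tensor_eq_zero_right hTt hz hB, mul_zero, Finset.sum_const_zero, sum_ambIdx, hΓ,
      zero_mul, zero_add]
    rw [tensor_eq_zero_right hTt hz (by simp), tensor_eq_zero_right hTt hz (by simp)]
    simp
  simp only [divergence₂, sum_ambIdx, hA.inv_eq hz, ambInverse, zero_mul, zero_add, add_zero,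
    Finset.sum_const_zero, Matrix.cons_val_zero]
  rw [h0 _ _ (by simp) fun k => by rw [hA.christoffel_inr_inl hz]; simp,
    h0 _ _ (by simp) fun k => by rw [hA.christoffel_inl_inr hz]; simp,
    h0 _ _ (by simp) fun k => by rw [hA.christoffel_inr_inr hz]]
  ring

include hA in
theorem divergence₂_mid (hT : IsSmoothTensorOn T U) {t ρ : ℝ} {x : EuclideanSpace ℝ (Fin n)}
    (hz : (t, x, ρ) ∈ V) (i : Fin n) :
    divergence₂ (ambBasis n) Gt Tt (t, x, ρ) ![Sum.inr (Sum.inl i)]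
      = (t * (1 + lam * ρ)) ^ (w - 2) * divergence₂ (stdBasis n) G T x ![i] := by
  rw [hA.divergence₂_eq_sum hTt hz, ← hA.tau_rpow_sub_two hz, divergence₂]
  simp only [Finset.mul_sum]
  refine Finset.sum_congr rfl fun j _ => Finset.sum_congr rfl fun q _ => ?_
  have hc : covDeriv (ambBasis n) Gt Tt (t, x, ρ)
      ![Sum.inr (Sum.inl q), Sum.inr (Sum.inl i), Sum.inr (Sum.inl j)]
      = (t * (1 + lam * ρ)) ^ w * covDeriv (stdBasis n) G T x ![q, i, j] := by
    rw [covDeriv_rank_two, covDeriv_rank_two,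
      pderiv_separable_mid q (φ := fun s u => (s * (1 + lam * u)) ^ w) (h := fun y => T y ![i, j])
        ((hA.eventually hz).mono fun z hz => tensor_mid_mid hTt hz i j)
        (hA.differentiableAt_tau_rpow hz w)
        (differentiableAt_of_contDiffAt (hT _ x (hA.mem _ hz)))]
    simp only [sum_ambIdx]
    rw [tensor_eq_zero_left hTt hz (by simp), tensor_eq_zero_left hTt hz (by simp),
      tensor_eq_zero_right hTt hz (by simp), tensor_eq_zero_right hTt hz (by simp)]
    simp only [tensor_mid_mid hTt hz, hA.christoffel_mid_mid_mid hz, mul_zero, zero_add, add_zero,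
      mul_sub, mul_add, Finset.mul_sum]
    refine congrArg₂ (· - ·) rfl (congrArg₂ (· + ·) ?_ ?_) <;>
      exact Finset.sum_congr rfl fun l _ => by ring
  rw [hc]
  simp only [Matrix.cons_val_zero]
  ring

include hA in
-- A pulled-back tensor vanishes on normal vectors, but its derivative does not. Only the connection
-- term that turns the normal index `A` into a base index survives, and contracting it gives the
-- trace. In use `d` is the logarithmic derivative of `τ` along `A`, so the result is a component of
-- `-τ^(w-3) tr dτ`.
theorem divergence₂_normal {t ρ : ℝ} {x : EuclideanSpace ℝ (Fin n)} (hz : (t, x, ρ) ∈ V)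
    {A : AmbIdx n} (hn : ∀ i, A ≠ Sum.inr (Sum.inl i)) {d : ℝ}
    (hΓ : ∀ i k, christoffel (ambBasis n) Gt (Sum.inr (Sum.inl i)) A (Sum.inr (Sum.inl k)) (t, x, ρ)
      = if i = k then d else 0) :
    divergence₂ (ambBasis n) Gt Tt (t, x, ρ) ![A]
      = -(d * (t * (1 + lam * ρ)) ^ (w - 2) * trace₂ G T x ![]) := by
  rw [hA.divergence₂_eq_sum hTt hz, ← hA.tau_rpow_sub_two hz, trace₂, Finset.sum_comm]
  simp only [Finset.mul_sum, ← Finset.sum_neg_distrib]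
  refine Finset.sum_congr rfl fun q _ => Finset.sum_congr rfl fun j _ => ?_
  have hc : covDeriv (ambBasis n) Gt Tt (t, x, ρ) ![Sum.inr (Sum.inl q), A, Sum.inr (Sum.inl j)]
      = -(d * ((t * (1 + lam * ρ)) ^ w * T x ![q, j])) := by
    rw [covDeriv_rank_two, pderiv_congr ((hA.eventually hz).mono fun z hz =>
      tensor_eq_zero_left hTt hz hn _), pderiv_const]
    simp only [sum_ambIdx, tensor_eq_zero_left hTt hz hn, mul_zero, Finset.sum_const_zero]
    rw [tensor_eq_zero_left hTt hz (by simp), tensor_eq_zero_left hTt hz (by simp)]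
    simp [hΓ, tensor_mid_mid hTt hz]
  rw [hc, hA.base.inv_symm (hA.mem _ hz)]
  ring

include hA in
theorem doubleDiv_eq (hT : IsSmoothTensorOn T U) (hTt' : IsSmoothTensorOn Tt V) {t ρ : ℝ}
    {x : EuclideanSpace ℝ (Fin n)} (hz : (t, x, ρ) ∈ V) :
    doubleDiv (ambBasis n) Gt Tt (t, x, ρ) = (t * (1 + lam * ρ)) ^ (w - 4)
      * (doubleDiv (stdBasis n) G T x - 2 * lam * (w - 3 + n) * trace₂ G T x ![]) := by
  rw [doubleDiv_eq_divergence hA.isMetricOn hTt' hz,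
    doubleDiv_eq_divergence hA.base hT (hA.mem _ hz)]
  -- The divergence of `τ^w π^*T` is `τ^(w-2) π^*(div T) - τ^(w-3) tr dτ`, hence `c = -1`.
  have h := hA.divergence_eq hz (r := w - 2) (c := -1)
    (W := divergence₂ (ambBasis n) Gt Tt) (α := divergence₂ (stdBasis n) G T)
    (f := fun y => trace₂ G T y ![]) (hA.isSmooth_divergence₂ hT)
    (fun y hy => differentiableAt_of_contDiffAt (hA.base.isSmooth_trace₂ hT _ y hy))
    (fun z hz i => hA.divergence₂_mid hTt hT hz i)
    (fun z hz => by
      have ht := (hA.pos _ hz).ne'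
      rw [hA.divergence₂_normal hTt hz (by simp) (hA.christoffel_mid_inl_mid hz),
        hA.tau_rpow_sub_one hz]
      field_simp)
    (fun z hz => by
      have hr := (hA.one_add_pos _ hz).ne'
      rw [hA.divergence₂_normal hTt hz (by simp) (hA.christoffel_mid_inr_mid hz),
        hA.tau_rpow_sub_one hz]
      field_simp)
  rw [h]
  ring_nf

include hA in
theorem laplacian_trace₂_eq (hT : IsSmoothTensorOn T U) {t ρ : ℝ} {x : EuclideanSpace ℝ (Fin n)}
    (hz : (t, x, ρ) ∈ V) :
    laplacian (ambBasis n) Gt (trace₂ Gt Tt) (t, x, ρ) = (t * (1 + lam * ρ)) ^ (w - 4)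
      * (laplacian (stdBasis n) G (trace₂ G T) x
        + 2 * lam * (w - 2) * (w - 3 + n) * trace₂ G T x ![]) := by
  have hs := hA.base.isSmooth_trace₂ hT
  have hd : ∀ y ∈ U, DifferentiableAt ℝ (fun y => trace₂ G T y ![]) y := fun y hy =>
    differentiableAt_of_contDiffAt (hs _ y hy)
  rw [laplacian_eq_divergence, laplacian_eq_divergence]
  -- The ambient trace is `τ^(w-2)` times the base trace; differentiating the power puts `w - 2` in
  -- front of `dτ`.
  have h := hA.divergence_eq hz (r := w - 2) (c := w - 2)
    (W := covDeriv (ambBasis n) Gt (trace₂ Gt Tt)) (α := covDeriv (stdBasis n) G (trace₂ G T))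
    (f := fun y => trace₂ G T y ![]) (hA.base.isSmooth_covDeriv _ hs) hd
    (fun z hz i => by
      rw [covDeriv_rank_zero, covDeriv_rank_zero]
      exact pderiv_separable_mid i (φ := fun s u => (s * (1 + lam * u)) ^ (w - 2))
        ((hA.eventually hz).mono fun z hz => hA.trace₂_eq hTt hz _)
        (hA.differentiableAt_tau_rpow hz _) (hd _ (hA.mem _ hz)))
    (fun z hz => by
      rw [covDeriv_rank_zero]
      refine (pderiv_separable_inl (φ := fun s u => (s * (1 + lam * u)) ^ (w - 2))
        ((hA.eventually hz).mono fun z hz => hA.trace₂_eq hTt hz _)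
        (hA.differentiableAt_tau_rpow hz _) (hd _ (hA.mem _ hz))
        (hA.hasDerivAt_tau_rpow_left hz _)).trans ?_
      ring)
    (fun z hz => by
      rw [covDeriv_rank_zero]
      refine (pderiv_separable_inr (φ := fun s u => (s * (1 + lam * u)) ^ (w - 2))
        ((hA.eventually hz).mono fun z hz => hA.trace₂_eq hTt hz _)
        (hA.differentiableAt_tau_rpow hz _) (hd _ (hA.mem _ hz))
        (hA.hasDerivAt_tau_rpow_right hz _)).trans ?_
      ring)
  rw [h]
  ring_nf

end IsAmbientOn

end PulledBackTensors

/-! ### The ambient metric of an Einstein manifold in a chart -/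

section AmbientMetric

variable {n : ℕ} {M : Type u} [TopologicalSpace M] [ChartedSpace (EuclideanSpace ℝ (Fin n)) M]
  {e : OpenPartialHomeomorph M (EuclideanSpace ℝ (Fin n))}

theorem ambCoord_eq_ambMatrix (g : PseudoMetric (𝓡 n) M) (lam : ℝ)
    (he : e ∈ IsManifold.maximalAtlas (𝓡 n) ∞ M) {x : EuclideanSpace ℝ (Fin n)}
    (hx : x ∈ (e.extend (𝓡 n)).target) (t ρ : ℝ) :
    ambCoord g lam e (t, x, ρ) = ambMatrix (g.coord e) lam (t, x, ρ) := by
  have h : ∀ A B, ambCoord g lam e (t, x, ρ) A B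
      = (2 * ρ) * ((ambBasis n A).1 * (ambBasis n B).1)
        + t * ((ambBasis n A).1 * (ambBasis n B).2.2 + (ambBasis n A).2.2 * (ambBasis n B).1)
        + (t * (1 + lam * ρ)) ^ 2 * g.form ((e.extend (𝓡 n)).symm x)
          (coordVec (𝓡 n) e x (ambBasis n A).2.1) (coordVec (𝓡 n) e x (ambBasis n B).2.1) := by
    intro A B
    rw [ambCoord, metricCoord, Matrix.of_apply, coordVec_ambChart he hx, coordVec_ambChart he hx]
    rfl
  have h0 : coordVec (𝓡 n) e x 0 = 0 := map_zero _
  have hl : ∀ v, g.form ((e.extend (𝓡 n)).symm x) (coordVec (𝓡 n) e x 0) v = 0 := fun v => by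
    rw [h0, map_zero]
    rfl
  have hr : ∀ v, g.form ((e.extend (𝓡 n)).symm x) v (coordVec (𝓡 n) e x 0) = 0 := fun v => by
    rw [h0, map_zero]
  ext A B
  rw [h]
  rcases A with _ | i | _ <;> rcases B with _ | j | _ <;>
    simp only [ambBasis_inl, ambBasis_mid, ambBasis_inr, ambMatrix, PseudoMetric.coord_apply, hl,
      hr] <;> ring

theorem isAmbientOn_ambCoord (g : PseudoMetric (𝓡 n) M) (lam : ℝ)
    (he : e ∈ IsManifold.maximalAtlas (𝓡 n) ∞ M) {ε : ℝ}
    (hε : ∀ ρ ∈ Set.Ioo (-ε) ε, 0 < 1 + lam * ρ) :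
    IsAmbientOn (ambCoord g lam e) (g.coord e) lam (e.extend (𝓡 n)).target
      (Set.Ioi 0 ×ˢ ((e.extend (𝓡 n)).target ×ˢ Set.Ioo (-ε) ε)) where
  base := g.isMetricOn_coord he
  isOpen := isOpen_Ioi.prod (e.isOpen_extend_target.prod isOpen_Ioo)
  pos _ hz := hz.1
  mem _ hz := hz.2.1
  one_add_pos _ hz := hε _ hz.2.2
  eq_ambMatrix z hz := ambCoord_eq_ambMatrix g lam he hz.2.1 z.1 z.2.2

end AmbientMetric

end RiemInv

/-! ### The theorem -/

theorem mainTheorem7 (n : ℕ) (hn : 3 ≤ n) (w : ℝ) (hw : w ≠ 2)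
    (T : RiemInv.TensorInvariant 2)
    (hsymm : RiemInv.TensorInvariant.IsSymmetric.{u} T n)
    (hT : RiemInv.TensorInvariant.IsStraightenable.{u} T n w) :
    ∃ S : RiemInv.TensorInvariant 0,
      RiemInv.IsDoubleDivAddLaplacianTrace.{u} S T (1 / (w - 2)) ∧
      RiemInv.TensorInvariant.IsStraightenable.{u} S n (w - 4) := by
  have hw' : w - 2 ≠ 0 := sub_ne_zero.mpr hw
  refine ⟨T.doubleDivAddLaplacianTrace (1 / (w - 2)), ?_, ?_, ?_⟩
  · intro m M _ _ _ _ _ g e he x hx a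
    exact T.comp_doubleDivAddLaplacianTrace _ (g.isMetricOn_coord he) hx a
  · intro M _ _ _ _ _ g c hc e he x hx a
    have hG := g.isMetricOn_coord he
    have hs : c ^ 2 ≠ 0 := pow_ne_zero 2 hc.ne'
    have hS := T.isSmooth_comp (b := RiemInv.stdBasis n) hG
    have hTw := fun y hy r => hT.1 M g c hc e he y hy r
    refine (T.comp_doubleDivAddLaplacianTrace _ ((g.rescale c hc).isMetricOn_coord he) hx a).trans ?_
    refine Eq.trans ?_ (congrArg (c ^ (w - 4) * ·)
      (T.comp_doubleDivAddLaplacianTrace _ hG hx a).symm)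
    -- Two contractions with the inverse metric contribute `c⁻²` each.
    have hpow : c ^ (w - 4) = (c ^ 2)⁻¹ * (c ^ 2)⁻¹ * c ^ w := by
      rw [Real.rpow_sub hc, show (4 : ℝ) = (4 : ℕ) by norm_num, Real.rpow_natCast]
      field_simp
    have h1 := hG.doubleDiv_smul (b := RiemInv.stdBasis n) hs hS hTw hx
    have h2 := hG.laplacian_trace₂_smul (b := RiemInv.stdBasis n) hs hS hTw hx
    rw [hpow, mul_add, ← h1, mul_left_comm, ← h2]
    rfl
  · intro M _ _ _ _ _ g lam hg ε hε hpos e he t ht x hx ρ hρ A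
    have hA := RiemInv.isAmbientOn_ambCoord g lam he hpos
    have hz : (t, x, ρ) ∈ Set.Ioi 0 ×ˢ ((e.extend (𝓡 n)).target ×ˢ Set.Ioo (-ε) ε) :=
      ⟨ht, hx, hρ⟩
    -- Straightness of `T` is needed on the whole open box, because its ambient value will be
    -- differentiated twice.
    have hTt := fun z (hz : z ∈ Set.Ioi 0 ×ˢ ((e.extend (𝓡 n)).target ×ˢ Set.Ioo (-ε) ε)) B =>
      hT.2 M g lam hg ε hε hpos e he z.1 hz.1 z.2.1 hz.2.1 z.2.2 hz.2.2 B
    have hS := T.isSmooth_comp (b := RiemInv.stdBasis n) hA.base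
    rw [T.comp_doubleDivAddLaplacianTrace _ hA.isMetricOn hz, RiemInv.pullbackProj_rank_zero _ _ ![],
      hA.doubleDiv_eq hTt hS (T.isSmooth_comp hA.isMetricOn) hz,
      hA.laplacian_trace₂_eq hTt hS hz]
    change _ = _ * (RiemInv.TensorInvariant.doubleDivAddLaplacianTrace T _).comp
      (RiemInv.stdBasis n) (g.coord e) x ![]
    rw [T.comp_doubleDivAddLaplacianTrace _ hA.base hx]
    simp only [RiemInv.TensorInvariant.eval]
    -- The remainders `-2λ (w - 3 + n) tr` and `(1/(w-2)) · 2λ (w-2)(w - 3 + n) tr` cancel; this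
    -- uses `w ≠ 2`.
    field_simp
    ring
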